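/- **Lattices.** Let $\varepsilon_0>0$, $L_0\in\mathbb N_{\ge1}$, $L=\varepsilon_0L_0$, $\varepsilon_N=2^{-N}\varepsilon_0$, $L_N=2^NL_0$, and $\Lambda_N=\varepsilon_N\{-L_N,\dots,L_N-1\}$. Put $\Gamma_{\infty,+}=\frac{\pi}{L}\mathbb Z$ (periodic, Ramond) and $\Gamma_{\infty,-}=\frac{\pi}{L}(\mathbb Z+\frac12)$ (antiperiodic, Neveu–Schwarz), and let $\Gamma_{N,\pm}\subset\Gamma_{\infty,\pm}$ be the Brillouin zones $\frac{\pi}{L}\{-L_N,\dots,L_N-1\}$, resp. $\frac{\pi}{L}(\{-L_N,\dots,L_N-1\}+\frac12)$. The boundary condition $b\in\{+,-\}$ and the chirality $\tau\in\{+,-\}$ are chosen independently. **Loops.** Let $s$ be a compactly supported orthonormal Daubechies scaling function of order $K\ge2$: $\int s=1$, the integer translates of $s$ are orthonormal, $s(x)=\sum_{n=0}^{2K-1}h_n\sqrt2\,s(2x-n)$ with $h_n\in\mathbb R$, and $m_0(l)=\frac1{\sqrt2}\sum_nh_ne^{-iln}$ has the form $m_0(l)=\big(\frac{1+e^{-il}}2\big)^Kq(e^{-il})$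 with a real polynomial $q$ such that $|q(e^{-il})|^2=\sum_{j<K}\binom{K-1+j}{j}\sin^{2j}(l/2)$. Assume $s\in C^2(\mathbb R)$. For a loop $X:\Lambda_M\to\mathbb C$ let $\hat X_k=\sum_{x\in\Lambda_M}e^{-ikx}X(x)$, $k\in\Gamma_{\infty,+}$, let $(\cdot)_{\mathrm{per}}$ denote $2\pi/\varepsilon_N$-periodic extension from $\Gamma_{N,+}$, and define $$S^N_{N+1}(\hat Y)_k=2m_0(\varepsilon_{N+1}k)(\hat Y_{\mathrm{per}})_k,\qquad S^M_N=S^{N-1}_N\cdots S^M_{M+1},\qquad S^M_\infty(\hat X)_k=\varepsilon_M\hat s(\varepsilon_Mk)(\hat X_{\mathrm{per}})_k ,$$ where $\hat s(l)=\int e^{-ilx}s(x)\,dx$. **Fermions.** Let $e_l$, $l\in\Gamma_{\infty,b}$, be the plane waves, with $\|e_l\|^2=2L$; let $\mathcal D_{\mathrm{std}}$ be their finite linear span, $J$ the complex conjugation of Fourier coefficients, and $\hat\psi_l=\psi(e_l)$ ($\psi$ antilinear, $\psi^\dagger$ linear). In an antisymmetric Fock space with vacuum $\Omega_0$, consider the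 representations of the chiral fermion of chirality $\tau=\pm$: * $b=-$: $\pi_-(\psi(\xi))=a(P^{\pm}\xi)+a^\dagger(JP^{\mp}\xi)$, with $P^{\pm}$ the projections onto positive/negative momenta; * $b=+$: $\pi_+(\psi(\xi))=a(P_{S_\pm}(\xi\oplus0))+a^\dagger((J\oplus J)P_{S_\mp}(\xi\oplus0))$ on the Fock space of the doubled one-particle space (there $\mathcal D_{\mathrm{std}}$ is replaced by $\mathcal D_{\mathrm{std}}\oplus\mathcal D_{\mathrm{std}}$), where $P_{S_\sigma}=\mathrm{diag}(\theta(\sigma k),\theta(-\sigma k))$ at momenta $k\ne0$ and $P_{S_\sigma}=\frac12\begin{pmatrix}1&\sigma\\\sigma&1\end{pmatrix}$ at $k=0$. Normal ordering $:\cdot:$ is with respect to $a,a^\dagger$. **Generators.** For $k\in\Gamma_{\infty,+}$ and $\tau=\pm$, $$L_{\pm,k}=\pm\tfrac1{2\pi}\sum_{l\in\Gamma_{\infty,b}}(l\mp\tfrac k2):\!\pi_b(\hat\psi^\dagger_{l\mp k}\hat\psi_l)\!:\;+\;z\,\delta_{k,0},\qquad L_\pm(Y)=\tfrac1{2L}\sum_{k\in\Gamma_{\infty,+}}\hat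 Y_kL_{\pm,k},$$ with zero-point constant $z$. The chiral Koo–Saleur approximants are $$L^{(N)}_{\pm,k}=\pm\tfrac1{2\pi}\sum_{l\in\Gamma_{N,b}}\cos^2(\tfrac14\varepsilon_Nk)\sin(\varepsilon_N(l\mp\tfrac k2))\,\hat\psi^\dagger_{l\mp k}\hat\psi_l,\qquad L^{(N)}_\pm(Y)=\tfrac1{2L_N}\sum_{k\in\Gamma_{N,+}}\hat Y_kL^{(N)}_{\pm,k},$$ where $\hat\psi_p=\psi(e_p)$ is now built from the lattice plane waves (of norm $\|e_p\|^2=2L_N$). They are mapped to the continuum by the momentum-cutoff renormalization group $\alpha^N_\infty(\hat\psi_p)=\varepsilon_N^{-1/2}\hat\psi_p$, $p\in\Gamma_{N,b}$. In the bilinears with $l\in\Gamma_{N,b}$ but $l\mp k\notin\Gamma_{N,b}$ the momentum $l\mp k$ is not reduced modulo $2\pi/\varepsilon_N$: either one uses $\alpha^N_\infty(\hat\psi_p)=\varepsilon_N^{-1/2}\hat\psi_p$ for all $p$, or one drops these bilinears. **Theorem.** For either of these two conventions, every $M\in\mathbb N_0$, every loop $X:\Lambda_M\to\mathbb C$, every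 chirality $\tau=\pm$ and every boundary condition $b$, and for every $\Phi$ in the linear span of the vectors $a^\dagger(\xi_1)\cdots a^\dagger(\xi_n)\Omega_0$ with $n\in\mathbb N_0$, $\xi_i\in\mathcal D_{\mathrm{std}}$ ($\xi_i\in\mathcal D_{\mathrm{std}}\oplus\mathcal D_{\mathrm{std}}$ if $b=+$), the series for $L_{\pm,k}\Phi$ and for $L_\pm(S^M_\infty X)\Phi$ converge unconditionally in Fock space, and, with $z=0$, $$\lim_{N\to\infty}\Big\|\Big(:\!\pi_b\big(\alpha^N_\infty(L^{(N)}_\pm(S^M_NX))\big)\!:\;-\;L_\pm(S^M_\infty X)\Big)\Phi\Big\|=0 .$$ For $b=+$ the same holds with the zero-point constant $z=\frac18$ in $L_{\pm,0}$, if the corresponding constant $\frac1{2L_N}S^M_N(X)_0\cdot\frac18$ is added to the approximants. -/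

import Mathlib

namespace KooSaleur

noncomputable section

/-! ### Lattices, momenta, boundary conditions, chirality -/

/-- The circle of circumference `2L`, `L = ε₀ L₀`, with its dyadic lattices of spacing
`ε_N = 2^{-N} ε₀` and `2 L_N = 2 (2^N L₀)` sites. -/
structure Geometry where
  eps0 : ℝ
  L0 : ℕ
  eps0_pos : 0 < eps0
  L0_pos : 0 < L0

namespace Geometry

/-- Half the circumference. -/
def L (g : Geometry) : ℝ := g.eps0 * g.L0

/-- The lattice spacing `ε_N`. -/
def eps (g : Geometry) (N : ℕ) : ℝ := g.eps0 / 2 ^ N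

/-- The number `L_N`, so that `ε_N L_N = L`. -/
def num (g : Geometry) (N : ℕ) : ℕ := 2 ^ N * g.L0

/-- The index set `{-L_N, …, L_N - 1}`. It labels the sites `ε_N n` of the lattice `Λ_N` and also,
through `mom` below, the momenta of the Brillouin zones `Γ_{N,+}` and `Γ_{N,-}`. -/
def zone (g : Geometry) (N : ℕ) : Finset ℤ := Finset.Ico (-(g.num N : ℤ)) (g.num N : ℤ)

/-- The representative of `j` modulo `2 L_N` in `zone N`. -/
def red (g : Geometry) (N : ℕ) (j : ℤ) : ℤ :=
  (j + (g.num N : ℤ)) % (2 * (g.num N : ℤ)) - (g.num N : ℤ)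

end Geometry

/-- Boundary conditions: antiperiodic (Neveu-Schwarz) or periodic (Ramond). -/
inductive Sector where
  | neveuSchwarz
  | ramond

/-- `Γ_∞` is `(π/L)(ℤ + 1/2)` in the Neveu-Schwarz and `(π/L) ℤ` in the Ramond sector. -/
def Sector.shift : Sector → ℝ
  | .neveuSchwarz => 1 / 2
  | .ramond => 0

/-- The momentum with index `j`. -/
def mom (g : Geometry) (b : Sector) (j : ℤ) : ℝ := Real.pi / g.L * ((j : ℝ) + b.shift)

/-- The momentum of a loop Fourier mode; loops are periodic in either sector. -/
def loopMom (g : Geometry) (j : ℤ) : ℝ := mom g .ramond j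

/-- The two chiral components. -/
inductive Chirality where
  | plus
  | minus

/-- The sign of a chirality. -/
def Chirality.sgn : Chirality → ℤ
  | .plus => 1
  | .minus => -1

/-! ### Daubechies scaling functions and the wavelet renormalization of loops -/

/-- The symbol `m₀(l) = 2^{-1/2} ∑ₙ hₙ e^{-iln}` of a low-pass filter. -/
def lowPass {K : ℕ} (h : Fin (2 * K) → ℝ) (l : ℝ) : ℂ :=
  ((1 / Real.sqrt 2 : ℝ) : ℂ) *
    ∑ n : Fin (2 * K), (h n : ℂ) * Complex.exp (-(Complex.I * (l : ℂ) * ((n : ℕ) : ℂ)))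

/-- `s` is a compactly supported orthonormal Daubechies scaling function of order `K`, with
low-pass filter `h` of length `2K`: `m₀(l) = ((1 + e^{-il})/2)^K 𝓛(l)` where `𝓛` is a trigonometric
polynomial with `|𝓛(l)|² = ∑_{j < K} binom(K-1+j, j) sin(l/2)^{2j}`. -/
structure IsDaubechies (K : ℕ) (h : Fin (2 * K) → ℝ) (s : ℝ → ℝ) : Prop where
  two_le : 2 ≤ K
  compactSupport : HasCompactSupport s
  integral_eq_one : ∫ x, s x = 1
  orthonormal : ∀ n : ℤ, ∫ x, s x * s (x - (n : ℝ)) = if n = 0 then 1 else 0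
  scaling : ∀ x, s x = ∑ n : Fin (2 * K), h n * Real.sqrt 2 * s (2 * x - ((n : ℕ) : ℝ))
  factorization : ∃ q : Polynomial ℝ, ∀ l : ℝ,
    lowPass h l = ((1 + Complex.exp (-(Complex.I * (l : ℂ)))) / 2) ^ K *
        Polynomial.aeval (Complex.exp (-(Complex.I * (l : ℂ)))) q ∧
      ‖Polynomial.aeval (Complex.exp (-(Complex.I * (l : ℂ)))) q‖ ^ 2 =
        ∑ j ∈ Finset.range K, ((K - 1 + j).choose j : ℝ) * Real.sin (l / 2) ^ (2 * j)

/-- `ŝ(l) = ∫ e^{-ilx} s(x) dx`. -/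
def scalingHat (s : ℝ → ℝ) (l : ℝ) : ℂ :=
  ∫ x : ℝ, Complex.exp (-(Complex.I * (l : ℂ) * (x : ℂ))) * (s x : ℂ)

/-- The lattice Fourier transform `X̂_k = ∑_{x ∈ Λ_M} e^{-ikx} X(x)` of a loop on `Λ_M`, as a
function of the index of `k`. -/
def loopHat (g : Geometry) (M : ℕ) (X : g.zone M → ℂ) (j : ℤ) : ℂ :=
  ∑ n : g.zone M,
    Complex.exp (-(Complex.I * ((loopMom g j : ℝ) : ℂ) * ((g.eps M * ((n : ℤ) : ℝ) : ℝ) : ℂ))) * X n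

/-- `S^N_{N+1}(Ŷ)_k = 2 m₀(ε_{N+1} k) (Ŷ_per)_k`. -/
def loopStep (g : Geometry) {K : ℕ} (h : Fin (2 * K) → ℝ) (N : ℕ) (Y : ℤ → ℂ) : ℤ → ℂ :=
  fun j => 2 * lowPass h (g.eps (N + 1) * loopMom g j) * Y (g.red N j)

/-- `S^M_{M+d}`, the composition of the `d` steps from scale `M` to scale `M + d`. -/
def loopScale (g : Geometry) {K : ℕ} (h : Fin (2 * K) → ℝ) (M : ℕ) : ℕ → (ℤ → ℂ) → ℤ → ℂ
  | 0, Y => Y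
  | d + 1, Y => loopStep g h (M + d) (loopScale g h M d Y)

/-- `S^M_∞(Ŷ)_k = ε_M ŝ(ε_M k) (Ŷ_per)_k`. -/
def loopLimit (g : Geometry) (s : ℝ → ℝ) (M : ℕ) (Y : ℤ → ℂ) : ℤ → ℂ :=
  fun j => ((g.eps M : ℝ) : ℂ) * scalingHat s (g.eps M * loopMom g j) * Y (g.red M j)

/-! ### Antisymmetric Fock space

`I` labels an orthonormal basis `(u_i)` of a one-particle Hilbert space. The vectors
`u_{i₁} ∧ ⋯ ∧ u_{iₙ}` with `i₁ < ⋯ < iₙ` are an orthonormal basis of the antisymmetric Fock space,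
which is thereby `ℓ²` of the finite subsets of `I`. -/

section Fock

variable {I : Type} [LinearOrder I]

/-- The antisymmetric Fock space. -/
abbrev Fock (I : Type) : Type := lp (fun _ : Finset I => ℂ) 2

/-- Finite linear combinations of the basis vectors of Fock space. -/
abbrev FockAlg (I : Type) : Type := Finset I →₀ ℂ

/-- The inclusion into Fock space. -/
def toFock : FockAlg I →ₗ[ℂ] Fock I :=
  Finsupp.linearCombination ℂ (fun A : Finset I => (lp.single 2 A (1 : ℂ) : Fock I))

/-- The vacuum. -/
def vacuum : FockAlg I := Finsupp.single ∅ 1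

/-- The sign from moving `u_i` into its place in the ordered wedge product over `A`. -/
def jwSign (i : I) (A : Finset I) : ℂ := (-1) ^ (A.filter (fun j => j < i)).card

/-- `a†(u_i) Ψ = u_i ∧ Ψ`. -/
def create1 (i : I) : FockAlg I →ₗ[ℂ] FockAlg I :=
  Finsupp.linearCombination ℂ (fun A : Finset I =>
    if i ∈ A then 0 else Finsupp.single (insert i A) (jwSign i A))

/-- `a(u_i)`, the adjoint of `a†(u_i)`. -/
def annih1 (i : I) : FockAlg I →ₗ[ℂ] FockAlg I :=
  Finsupp.linearCombination ℂ (fun A : Finset I =>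
    if i ∈ A then Finsupp.single (A.erase i) (jwSign i A) else 0)

/-- `a†(ξ)`, for `ξ = ∑ ξ_i u_i` a finite combination of basis vectors; linear in `ξ`. -/
def create (ξ : I →₀ ℂ) : FockAlg I →ₗ[ℂ] FockAlg I :=
  ξ.sum fun i c => c • create1 i

/-- `a(ξ)`; antilinear in `ξ`. -/
def annih (ξ : I →₀ ℂ) : FockAlg I →ₗ[ℂ] FockAlg I :=
  ξ.sum fun i c => (starRingEnd ℂ c) • annih1 i

/-- `a†(ξ₁) ⋯ a†(ξₙ) Ω₀`. -/
def productVector (ξ : List (I →₀ ℂ)) : FockAlg I := ξ.foldr (fun η Φ => create η Φ) vacuum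

/-- The linear span of the vectors `a†(ξ₁) ⋯ a†(ξₙ) Ω₀`. -/
def finiteParticle (I : Type) [LinearOrder I] : Submodule ℂ (FockAlg I) :=
  Submodule.span ℂ (Set.range (productVector (I := I)))

end Fock

/-! ### The quasi-free representations -/

/-- A representation `π(ψ(ξ)) = a(v ξ) + a†(w ξ)` of chiral fermions on the Fock space over `I`. The
one-particle vectors `ξ` are finite combinations of the normalized plane waves
`u_j = (2L)^{-1/2} e_{p(j)}` with the momenta `p(j) = mom g b j`, `j : ℤ`. -/
structure QuasiFreeRep (I : Type) where
  v : (ℤ →₀ ℂ) →ₗ[ℂ] (I →₀ ℂ)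
  w : (ℤ →₀ ℂ) →ₛₗ[starRingEnd ℂ] (I →₀ ℂ)

/-- Complex conjugation of the Fourier coefficients. -/
def conjJ (I : Type) : (I →₀ ℂ) →ₛₗ[starRingEnd ℂ] (I →₀ ℂ) where
  toFun ξ := ξ.mapRange (starRingEnd ℂ) (map_zero _)
  map_add' ξ η := by ext i; simp
  map_smul' c ξ := by ext i; simp

/-- The projection onto positive (`σ = plus`) or negative (`σ = minus`) momenta in the
Neveu-Schwarz sector, where the momentum index `j` stands for `(π/L)(j + 1/2)`. -/
def hardy (σ : Chirality) : (ℤ →₀ ℂ) →ₗ[ℂ] (ℤ →₀ ℂ) :=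
  Finsupp.linearCombination ℂ (fun j : ℤ =>
    if 0 < (σ.sgn : ℝ) * ((j : ℝ) + Sector.neveuSchwarz.shift) then Finsupp.single j 1 else 0)

/-- The opposite chirality. -/
def Chirality.opp : Chirality → Chirality
  | .plus => .minus
  | .minus => .plus

/-- `π_-(ψ_±(ξ)) = ψ_±(P^± ξ) + ψ_±†(J P^∓ ξ)`: the representation of the chiral fermions defined by
the scaling limit of the lattice vacua in the Neveu-Schwarz sector. -/
def repNS (τ : Chirality) : QuasiFreeRep ℤ where
  v := hardy τ
  w := (conjJ ℤ).comp (hardy τ.opp)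

/-- Labels of the basis `u_j ⊕ 0`, `0 ⊕ u_j` of the doubled one-particle space. -/
abbrev Doubled : Type := ℤ ×ₗ Fin 2

/-- `u_j` in the summand `c` of the doubled one-particle space. -/
def dbl (j : ℤ) (c : Fin 2) : Doubled →₀ ℂ := Finsupp.single (toLex (j, c)) 1

/-- `ξ ↦ P_{S_σ}(ξ ⊕ 0)`, where the projection `P_{S_σ}` on the doubled one-particle space is
`diag(θ(σk), θ(-σk))` at momenta `k ≠ 0` and `1/2` times `((1, σ), (σ, 1))` at `k = 0`. -/
def doubledProj (σ : Chirality) : (ℤ →₀ ℂ) →ₗ[ℂ] (Doubled →₀ ℂ) :=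
  Finsupp.linearCombination ℂ (fun j : ℤ =>
    if j = 0 then (1 / 2 : ℂ) • dbl 0 0 + ((σ.sgn : ℂ) / 2) • dbl 0 1
    else if 0 < σ.sgn * j then dbl j 0 else 0)

/-- `π_+(ψ_±(ξ)) = ψ_±(P_{S_±}(ξ ⊕ 0)) + ψ_±†((J ⊕ J) P_{S_∓}(ξ ⊕ 0))`: the representation of the
chiral fermions defined by the scaling limit of the lattice vacua in the Ramond sector. -/
def repR (τ : Chirality) : QuasiFreeRep Doubled where
  v := doubledProj τ
  w := (conjJ Doubled).comp (doubledProj τ.opp)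

/-- The normal-ordered product `:π(ψ†(ξ) ψ(η)):` with
`π(ψ†(ξ)) = a†(v ξ) + a(w ξ)` and `π(ψ(η)) = a(v η) + a†(w η)`. -/
def normalOrdered {I : Type} [LinearOrder I] (ρ : QuasiFreeRep I) (ξ η : ℤ →₀ ℂ) :
    FockAlg I →ₗ[ℂ] FockAlg I :=
  create (ρ.v ξ) ∘ₗ annih (ρ.v η) + create (ρ.v ξ) ∘ₗ create (ρ.w η)
    + annih (ρ.w ξ) ∘ₗ annih (ρ.v η) - create (ρ.w η) ∘ₗ annih (ρ.w ξ)

/-! ### Plane waves and the momentum-cutoff renormalization group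

In the orthonormal bases of normalized plane waves of `𝔥_N ≅ ℓ²(Γ_N, (2L_N)⁻¹)` and
`𝔥_∞ ≅ ℓ²(Γ_∞, (2L)⁻¹)`, the map `R^N_∞(ξ̂)_k = ε_N^{1/2} χ_{Γ_N}(k) ξ̂_k` keeps the coordinates in
`Γ_N` and drops the others. -/

/-- The plane wave `e_p` of the continuum, `‖e_p‖² = 2L`. -/
def wave (g : Geometry) (p : ℤ) : ℤ →₀ ℂ := Finsupp.single p ((Real.sqrt (2 * g.L) : ℝ) : ℂ)

/-- The plane wave `e_p` of the lattice, `‖e_p‖² = 2L_N`. -/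
def latticeWave (g : Geometry) (N : ℕ) (p : ℤ) : ℤ →₀ ℂ :=
  Finsupp.single p ((Real.sqrt (2 * (g.num N : ℝ)) : ℝ) : ℂ)

/-- The map `R^N_∞` of the momentum-cutoff renormalization group. -/
def cutoff (g : Geometry) (N : ℕ) (ξ : ℤ →₀ ℂ) : ℤ →₀ ℂ := ξ.filter (fun p => p ∈ g.zone N)

/-- The two readings of the bilinears `ψ̂†_{l∓k} ψ̂_l` with `l ∈ Γ_N` but `l ∓ k ∉ Γ_N`. -/
inductive EdgeConvention where
  /-- `α^N_∞(ψ̂_p) = ε_N^{-1/2} ψ̂_p` for all momenta `p`. -/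
  | keep
  /-- `α^N_∞(ψ̂_p) = ψ(R^N_∞ e_p)`, which is `ε_N^{-1/2} ψ̂_p` for `p ∈ Γ_N` and `0` otherwise. -/
  | cut

/-- The one-particle vector of `α^N_∞(ψ̂_p)`. -/
def renormalizedWave (g : Geometry) (E : EdgeConvention) (N : ℕ) (p : ℤ) : ℤ →₀ ℂ :=
  match E with
  | .keep => ((1 / Real.sqrt (g.eps N) : ℝ) : ℂ) • wave g p
  | .cut => cutoff g N (latticeWave g N p)

/-- On `Γ_N` both conventions give `ε_N^{-1/2} e_p`. -/
theorem cutoff_latticeWave (g : Geometry) (N : ℕ) (p : ℤ) (hp : p ∈ g.zone N) :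
    cutoff g N (latticeWave g N p) = ((1 / Real.sqrt (g.eps N) : ℝ) : ℂ) • wave g p := by
  have h0 : 0 < g.eps N := div_pos g.eps0_pos (by positivity)
  have h1 : 2 * (g.num N : ℝ) = 2 * g.L / g.eps N := by
    have := g.eps0_pos
    simp only [Geometry.num, Geometry.L, Geometry.eps]
    push_cast
    field_simp
  have h2 : 0 ≤ 2 * g.L := by
    have := g.eps0_pos
    simp only [Geometry.L]
    positivity
  rw [cutoff, latticeWave, wave, Finsupp.filter_single_of_pos _ hp, h1, Real.sqrt_div h2,
    Finsupp.smul_single, smul_eq_mul]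
  congr 1
  push_cast
  ring

/-! ### The Koo-Saleur approximants -/

/-- The one-particle symbol `h_k(l)` of the `k`-th Fourier mode of the massless lattice Dirac
Hamiltonian density, with `e = ε_N`. -/
def densitySymbol (e k l : ℝ) : Matrix (Fin 2) (Fin 2) ℂ :=
  !![0, Complex.exp (-(Complex.I * ((e * (l + k / 2) : ℝ) : ℂ))) * (Real.cos (e * k / 2) : ℂ) - 1;
    Complex.exp (Complex.I * ((e * (l + k / 2) : ℝ) : ℂ)) * (Real.cos (e * k / 2) : ℂ) - 1, 0]

/-- The symbol at `l` of the one-particle operator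
`(1/2) ε_N⁻¹ (h_{-τk} + (2 sin(ε_N k/2))⁻¹ [h_{-τk}, h₀])` of the Koo-Saleur approximant `L_k^{(N)}`
(for `τ = -`) or its antichiral partner (for `τ = +`); it maps `e_l` to a multiple of
`e_{l - τk}`. -/
def kooSaleurSymbol (e : ℝ) (τ : Chirality) (k l : ℝ) : Matrix (Fin 2) (Fin 2) ℂ :=
  ((1 / (2 * e) : ℝ) : ℂ) •
    (densitySymbol e (-(τ.sgn * k)) l + ((1 / (2 * Real.sin (e * k / 2)) : ℝ) : ℂ) •
      (densitySymbol e (-(τ.sgn * k)) l * densitySymbol e 0 l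
        - densitySymbol e 0 (l - τ.sgn * k) * densitySymbol e (-(τ.sgn * k)) l))

/-- The chiral vector `(e₁ ± i e₂)/√2`. -/
def chiralVec (τ : Chirality) : Fin 2 → ℂ :=
  ![((1 / Real.sqrt 2 : ℝ) : ℂ), (τ.sgn : ℂ) * Complex.I * ((1 / Real.sqrt 2 : ℝ) : ℂ)]

/-- The symbol `± ε_N⁻¹ cos(ε_N k/4)² sin(ε_N (l ∓ k/2))` of the chiral Koo-Saleur approximant
`L_{±,k}^{(N)}`, with `e = ε_N`. -/
def chiralSymbol (e : ℝ) (τ : Chirality) (k l : ℝ) : ℝ :=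
  τ.sgn * (1 / e) * Real.cos (e * k / 4) ^ 2 * Real.sin (e * (l - τ.sgn * k / 2))

/-- Where the Koo-Saleur formula is defined, `chiralSymbol` is its chiral component. -/
theorem chiralSymbol_eq (e : ℝ) (τ : Chirality) (k l : ℝ) (he : Real.sin (e * k / 2) ≠ 0) :
    (chiralSymbol e τ k l : ℂ) =
      star (chiralVec τ) ⬝ᵥ (kooSaleurSymbol e τ k l).mulVec (chiralVec τ) := by
  have hexp : ∀ x : ℝ, Complex.exp (Complex.I * (x : ℂ)) =
      (Real.cos x : ℂ) + (Real.sin x : ℂ) * Complex.I := by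
    intro x
    rw [mul_comm, Complex.exp_mul_I, Complex.ofReal_cos, Complex.ofReal_sin]
  have hexpn : ∀ x : ℝ, Complex.exp (-(Complex.I * (x : ℂ))) =
      (Real.cos x : ℂ) - (Real.sin x : ℂ) * Complex.I := by
    intro x
    have := hexp (-x)
    rw [Real.cos_neg, Real.sin_neg] at this
    rw [← mul_neg, ← Complex.ofReal_neg, this]
    push_cast
    ring
  have hs : ((1 / Real.sqrt 2 : ℝ) : ℂ) ^ 2 = 1 / 2 := by
    rw [← Complex.ofReal_pow, div_pow, Real.sq_sqrt (by norm_num)]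
    push_cast
    ring
  have hc : Real.cos (e * k / 2) = 2 * Real.cos (e * k / 4) ^ 2 - 1 := by
    rw [← Real.cos_two_mul]
    congr 1
    ring
  obtain ⟨t, ht, ht2⟩ : ∃ t : ℝ, (τ.sgn : ℝ) = t ∧ (t = 1 ∨ t = -1) := by
    cases τ <;> simp [Chirality.sgn]
  have htc : (τ.sgn : ℂ) = (t : ℂ) := by
    rw [← ht]
    norm_cast
  set a : ℝ := e * k / 2 with ha
  set θ : ℝ := e * (l - t * k / 2) with hθ
  have h1 : e * (l + 0 / 2) = θ + t * a := by rw [hθ, ha]; ring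
  have h2 : e * (l - t * k + 0 / 2) = θ - t * a := by rw [hθ, ha]; ring
  have h3 : e * (l + -(t * k) / 2) = θ := by rw [hθ]; ring
  have h4 : e * -(t * k) / 2 = -(t * a) := by rw [ha]; ring
  have h5 : e * 0 / 2 = 0 := by ring
  have hca : Real.cos (t * a) = Real.cos a := by
    rcases ht2 with rfl | rfl <;> simp
  have hsa : Real.sin (t * a) = t * Real.sin a := by
    rcases ht2 with rfl | rfl <;> simp
  have htt : (t : ℂ) ^ 2 = 1 := by
    rcases ht2 with rfl | rfl <;> simp
  have hp : (Real.sin θ : ℂ) ^ 2 + (Real.cos θ : ℂ) ^ 2 = 1 := by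
    exact_mod_cast Real.sin_sq_add_cos_sq θ
  have hpa : (Real.sin a : ℂ) ^ 2 + (Real.cos a : ℂ) ^ 2 = 1 := by
    exact_mod_cast Real.sin_sq_add_cos_sq a
  have he' : (Real.sin a : ℂ) ≠ 0 := by exact_mod_cast he
  have hq : (Real.cos (e * k / 4) : ℂ) ^ 2 = (1 + (Real.cos a : ℂ)) / 2 := by
    rw [hc]
    push_cast
    ring
  have hstar : star (chiralVec τ) = ![((1 / Real.sqrt 2 : ℝ) : ℂ),
      -((t : ℂ) * Complex.I * ((1 / Real.sqrt 2 : ℝ) : ℂ))] := by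
    funext i
    fin_cases i
    · simp [chiralVec]
    · simp [chiralVec, ← htc]
  rw [hstar]
  simp only [chiralSymbol, kooSaleurSymbol, densitySymbol, chiralVec, ht, htc, h1, h2, h3, h4, h5,
    hexp, hexpn, Real.cos_neg, hca, Real.cos_zero, Real.cos_add, Real.sin_add, Real.cos_sub,
    Real.sin_sub, hsa]
  rw [← hθ]
  simp only [dotProduct, Matrix.mulVec, Matrix.mul_apply, Matrix.smul_apply, Matrix.add_apply,
    Matrix.sub_apply, Fin.sum_univ_two, Matrix.of_apply, Matrix.cons_val_zero,
    Matrix.cons_val_one, smul_eq_mul]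
  have he0 : (e : ℂ) ≠ 0 := by
    rintro h0
    apply he
    rw [ha, Complex.ofReal_eq_zero.mp h0]
    simp
  rw [← ha]
  generalize ((1 / Real.sqrt 2 : ℝ) : ℂ) = r at hs ⊢
  generalize Real.cos (e * k / 4) = q at hq ⊢
  clear_value a θ
  generalize Real.sin a = S at *
  generalize Real.cos a = C at *
  generalize Real.sin θ = u at *
  generalize Real.cos θ = v at *
  push_cast
  rw [hq]
  clear hq hexp hexpn hstar
  generalize (S : ℂ) = S at *
  generalize (C : ℂ) = C at *
  generalize (u : ℂ) = u at *
  generalize (v : ℂ) = v at *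
  generalize (t : ℂ) = t at *
  generalize (e : ℂ) = e at *
  have hI : Complex.I ^ 2 + 1 = 0 := by simp
  generalize Complex.I = i at *
  field_simp
  linear_combination (-4 * u * t * S * (1 + C)) * hs +
    r ^ 2 * (4 * S * t * u * C + 4 * C * u * v * t * S) * hI +
    r ^ 2 * (((v + u * i) * C - 1) * ((v * C - u * t * S) - (u * C + v * t * S) * i - 1)
      - ((v * C + u * t * S) + (u * C - v * t * S) * i - 1) * ((v - u * i) * C - 1)) *
      (i ^ 2 * htt + hI)

/-- `:π(α^N_∞(L_{±,k}^{(N)})):` for the chiral Koo-Saleur approximant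
`L_{±,k}^{(N)} = (L/π) (2L_N)⁻¹ ∑_{l ∈ Γ_N} ± ε_N⁻¹ cos(ε_N k/4)² sin(ε_N (l ∓ k/2)) ψ̂†_{l∓k} ψ̂_l`
`= ± (2π)⁻¹ ∑_{l ∈ Γ_N} cos(ε_N k/4)² sin(ε_N (l ∓ k/2)) ψ̂†_{l∓k} ψ̂_l`. -/
def ksMode (g : Geometry) (b : Sector) (τ : Chirality) (E : EdgeConvention)
    {I : Type} [LinearOrder I] (ρ : QuasiFreeRep I) (N : ℕ) (k : ℤ) :
    FockAlg I →ₗ[ℂ] FockAlg I :=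
  ∑ l ∈ g.zone N,
    ((g.L / Real.pi * (1 / (2 * (g.num N : ℝ))) *
        chiralSymbol (g.eps N) τ (loopMom g k) (mom g b l) : ℝ) : ℂ) •
      normalOrdered ρ (renormalizedWave g E N (l - τ.sgn * k)) (renormalizedWave g E N l)

/-- `:π(α^N_∞(L_±^{(N)}(Y))):` with `L_±^{(N)}(Y) = (2L_N)⁻¹ ∑_{k ∈ Γ_{N,+}} Ŷ_k L_{±,k}^{(N)}`. -/
def ksSmeared (g : Geometry) (b : Sector) (τ : Chirality) (E : EdgeConvention)
    {I : Type} [LinearOrder I] (ρ : QuasiFreeRep I) (N : ℕ) (Y : ℤ → ℂ) :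
    FockAlg I →ₗ[ℂ] FockAlg I :=
  ((1 / (2 * (g.num N : ℝ)) : ℝ) : ℂ) • ∑ k ∈ g.zone N, Y k • ksMode g b τ E ρ N k

/-! ### The Virasoro generators -/

/-- The `l`-th term `± (2π)⁻¹ (l ∓ k/2) :π(ψ̂†_{l∓k} ψ̂_l): Φ` of `L_{±,k} Φ`. -/
def virasoroTerm (g : Geometry) (b : Sector) (τ : Chirality)
    {I : Type} [LinearOrder I] (ρ : QuasiFreeRep I) (k : ℤ) (Φ : FockAlg I) (l : ℤ) : FockAlg I :=
  ((τ.sgn * (1 / (2 * Real.pi)) * (mom g b l - τ.sgn * loopMom g k / 2) : ℝ) : ℂ) •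
    normalOrdered ρ (wave g (l - τ.sgn * k)) (wave g l) Φ

/-- `L_{±,k} Φ = ± (2π)⁻¹ ∑_{l ∈ Γ_∞} (l ∓ k/2) :π(ψ̂†_{l∓k} ψ̂_l): Φ`, plus `z Φ` for `k = 0`, where
`z` is the zero-point constant. -/
def virasoroMode (g : Geometry) (b : Sector) (τ : Chirality)
    {I : Type} [LinearOrder I] (ρ : QuasiFreeRep I) (z : ℝ) (k : ℤ) (Φ : FockAlg I) : Fock I :=
  (∑' l : ℤ, toFock (virasoroTerm g b τ ρ k Φ l)) + (if k = 0 then (z : ℂ) • toFock Φ else 0)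

/-- `L_±(Y) Φ = (2L)⁻¹ ∑_{k ∈ Γ_{∞,+}} Ŷ_k L_{±,k} Φ`. -/
def virasoroSmeared (g : Geometry) (b : Sector) (τ : Chirality)
    {I : Type} [LinearOrder I] (ρ : QuasiFreeRep I) (z : ℝ) (Y : ℤ → ℂ) (Φ : FockAlg I) : Fock I :=
  ((1 / (2 * g.L) : ℝ) : ℂ) • ∑' k : ℤ, Y k • virasoroMode g b τ ρ z k Φ

end

end KooSaleur

open KooSaleur Filter Topology

namespace KooSaleur

/-! Fix `Φ`. Both sides apply to `Φ` a combination of the bilinears `:π(ψ̂†_{l∓k} ψ̂_l):`, indexed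
by the pairs `(k, l)`; only the scalar coefficients depend on `N`. The proof is dominated
convergence for these coefficients in `ℓ²`, not in `ℓ¹`.

`ℓ²` suffices because the vectors obtained by applying the bilinears to `Φ` form a Bessel family
(`IsBessel`). On a basis vector `A`, a bilinear has bounded norm, and if it reaches `B` then both of
its momenta label elements of `A ∪ B`, where `B` has at most two elements more than `A`. So
boundedly many pairs contribute at each `B`, and `isBessel_of_multiplicity` applies. Normal ordering
also confines the nonzero vectors to `|l| ≤ R + |k|` (`exists_eq_zero`), since the only term that
annihilates nothing in `Φ` creates a pair from opposite sides of zero momentum.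

The coefficients factor into a loop part and a fermion part. For the fermions, `sin x = x sinc x`
writes the lattice coefficient as the continuum one times factors of modulus at most `1` that tend
to `1`. For the loop, the two-scale equation gives the exact identity `ε_N S^M_N(X)_k ŝ(ε_N k) =
S^M_∞(X)_k`. Continuity and `ŝ(0) = 1` give convergence; a positive lower bound of `|ŝ|` on `[-π,
π]` gives domination on the Brillouin zone by a multiple of the limit loop.

The majorant is square-summable: at fixed `k` there are `O(1 + |k|)` values of `l` with coefficients
`O(1 + |k|)`, so the sum over `l` costs `(1 + |k|)³`. Since `s` is `C²` with compact support,
Parseval for `s''` puts `k² ŝ(ε_M k)` in `ℓ²`, which is more than enough. -/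

/-! ### Bessel families -/

/-- A family of vectors whose synthesis map is bounded on square-summable coefficients. -/
def IsBessel {J H : Type*} [NormedAddCommGroup H] [NormedSpace ℂ H] (T : J → H) : Prop :=
  ∃ C : ℝ, 0 ≤ C ∧ ∀ (F : Finset J) (c : J → ℂ), ‖∑ j ∈ F, c j • T j‖ ≤ C * √(∑ j ∈ F, ‖c j‖ ^ 2)

namespace IsBessel

variable {J H : Type*} [NormedAddCommGroup H] [NormedSpace ℂ H] {T T' : J → H}

theorem zero : IsBessel (fun _ : J => (0 : H)) :=
  ⟨0, le_rfl, fun F c => by simp⟩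

theorem add (h : IsBessel T) (h' : IsBessel T') : IsBessel (fun j => T j + T' j) := by
  obtain ⟨C, hC, h⟩ := h
  obtain ⟨C', hC', h'⟩ := h'
  refine ⟨C + C', by positivity, fun F c => ?_⟩
  simp only [smul_add, Finset.sum_add_distrib]
  rw [add_mul]
  exact (norm_add_le _ _).trans (add_le_add (h F c) (h' F c))

theorem const_smul (h : IsBessel T) (a : ℂ) : IsBessel (fun j => a • T j) := by
  obtain ⟨C, hC, h⟩ := h
  refine ⟨‖a‖ * C, by positivity, fun F c => ?_⟩
  simp only [smul_comm _ a, ← Finset.smul_sum]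
  rw [norm_smul, mul_assoc]
  exact mul_le_mul_of_nonneg_left (h F c) (norm_nonneg _)

theorem comp_injective (h : IsBessel T) {J' : Type*} {f : J' → J} (hf : Function.Injective f) :
    IsBessel (fun j => T (f j)) := by
  obtain ⟨C, hC, h⟩ := h
  refine ⟨C, hC, fun F c => ?_⟩
  -- The coefficients are transported to `J` by extension by zero along `f`.
  have := h (F.map ⟨f, hf⟩) (Function.extend f c 0)
  simpa [Finset.sum_map, hf.extend_apply] using this

variable [CompleteSpace H]

theorem summable (h : IsBessel T) {c : J → ℂ} (hc : Summable fun j => ‖c j‖ ^ 2) :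
    Summable fun j => c j • T j := by
  obtain ⟨C, hC, h⟩ := h
  rw [summable_iff_vanishing_norm]
  intro ε hε
  -- Cauchy criterion; `C + 1` replaces `C`, which may be zero.
  obtain ⟨s, hs⟩ := summable_iff_vanishing_norm.1 hc ((ε / (C + 1)) ^ 2) (by positivity)
  refine ⟨s, fun t ht => (h t c).trans_lt ?_⟩
  have h1 := hs t ht
  rw [Real.norm_of_nonneg (Finset.sum_nonneg fun _ _ => by positivity)] at h1
  have h2 : √(∑ j ∈ t, ‖c j‖ ^ 2) ≤ ε / (C + 1) := Real.sqrt_le_iff.2 ⟨by positivity, h1.le⟩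
  calc C * √(∑ j ∈ t, ‖c j‖ ^ 2) ≤ C * (ε / (C + 1)) := by gcongr
    _ < (C + 1) * (ε / (C + 1)) := by gcongr; linarith
    _ = ε := by field_simp

theorem exists_norm_tsum_le (h : IsBessel T) : ∃ C : ℝ, ∀ c : J → ℂ,
    (Summable fun j => ‖c j‖ ^ 2) → ‖∑' j, c j • T j‖ ≤ C * √(∑' j, ‖c j‖ ^ 2) := by
  have hs := h
  obtain ⟨C, hC, h⟩ := h
  refine ⟨C, fun c hc => le_of_tendsto (hs.summable hc).hasSum.norm (.of_forall fun F => ?_)⟩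
  refine (h F c).trans ?_
  gcongr
  exact hc.sum_le_tsum F fun _ _ => by positivity

/-- Dominated convergence for the synthesis map. -/
theorem tendsto_tsum (h : IsBessel T) {c : ℕ → J → ℂ} {c' : J → ℂ} {W : J → ℝ}
    (hW : Summable fun j => W j ^ 2) (hb : ∀ᶠ n in atTop, ∀ j, ‖c n j‖ ≤ W j)
    (hlim : ∀ j, Tendsto (fun n => c n j) atTop (𝓝 (c' j))) :
    Tendsto (fun n => ‖∑' j, c n j • T j - ∑' j, c' j • T j‖) atTop (𝓝 0) := by
  have hb' : ∀ j, ‖c' j‖ ≤ W j := fun j =>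
    le_of_tendsto (hlim j).norm (hb.mono fun n hn => hn j)
  have hsum : ∀ {d : J → ℂ}, (∀ j, ‖d j‖ ≤ W j) → Summable fun j => ‖d j‖ ^ 2 := fun hd =>
    hW.of_nonneg_of_le (fun _ => by positivity) fun j => by gcongr; exact hd j
  obtain ⟨C, hC⟩ := h.exists_norm_tsum_le
  -- The limit inherits the bound `W`, so the squared differences have the summable majorant `(2 W)²
  -- = 4 W²`.
  have key : Tendsto (fun n => ∑' j, ‖c n j - c' j‖ ^ 2) atTop (𝓝 (∑' _ : J, (0 : ℝ))) := by
    refine tendsto_tsum_of_dominated_convergence (hW.mul_left 4) (fun j => ?_) ?_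
    · have := (((hlim j).sub_const (c' j)).norm.pow 2)
      simpa using this
    · filter_upwards [hb] with n hn j
      rw [Real.norm_of_nonneg (by positivity)]
      calc ‖c n j - c' j‖ ^ 2 ≤ (W j + W j) ^ 2 := by
            gcongr
            exact (norm_sub_le _ _).trans (add_le_add (hn j) (hb' j))
        _ = 4 * W j ^ 2 := by ring
  have key2 : Tendsto (fun n => C * √(∑' j, ‖c n j - c' j‖ ^ 2)) atTop (𝓝 0) := by
    simpa using (key.sqrt).const_mul C
  refine squeeze_zero' (.of_forall fun _ => norm_nonneg _) ?_ key2
  filter_upwards [hb] with n hn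
  rw [← ((h.summable (hsum hn)).tsum_sub (h.summable (hsum hb')))]
  simp only [← sub_smul]
  refine hC _ ?_
  refine (hW.mul_left 4).of_nonneg_of_le (fun _ => by positivity) fun j => ?_
  calc ‖c n j - c' j‖ ^ 2 ≤ (W j + W j) ^ 2 := by
        gcongr
        exact (norm_sub_le _ _).trans (add_le_add (hn j) (hb' j))
    _ = 4 * W j ^ 2 := by ring

end IsBessel

/-- Bounded vectors of `ℓ²` such that at most `n` of them are nonzero at any given point form a
Bessel family. -/
theorem isBessel_of_multiplicity {J β : Type*} (T : J → lp (fun _ : β => ℂ) 2) (D : ℝ) (n : ℕ)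
    (hD : ∀ j, ‖T j‖ ≤ D) (hn : ∀ (B : β) (F : Finset J), (∀ j ∈ F, T j B ≠ 0) → F.card ≤ n) :
    IsBessel T := by
  classical
  have hsq : ∀ f : lp (fun _ : β => ℂ) 2, HasSum (fun B => ‖f B‖ ^ 2) (‖f‖ ^ 2) := fun f => by
    simpa using lp.hasSum_norm (p := 2) (by simp) f
  refine ⟨√(n * D ^ 2), by positivity, fun F c => ?_⟩
  rw [← Real.sqrt_mul (by positivity)]
  refine Real.le_sqrt_of_sq_le ?_
  have h1 := hsq (∑ j ∈ F, c j • T j)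
  have h2 : HasSum (fun B => (n : ℝ) * ∑ j ∈ F, ‖c j‖ ^ 2 * ‖T j B‖ ^ 2)
      (n * ∑ j ∈ F, ‖c j‖ ^ 2 * ‖T j‖ ^ 2) :=
    (hasSum_sum fun j _ => (hsq (T j)).mul_left _).mul_left _
  -- At each point `B` at most `n` summands survive, so Cauchy–Schwarz costs a factor `n`; summing
  -- over `B` turns `|T j B|²` into `‖T j‖² ≤ D²`.
  refine (hasSum_le (fun B => ?_) h1 h2).trans ?_
  · have e : (∑ j ∈ F, c j • T j) B = ∑ j ∈ F with T j B ≠ 0, c j * T j B := by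
      rw [lp.coeFn_sum, Finset.sum_apply]
      simp only [lp.coeFn_smul, Pi.smul_apply, smul_eq_mul]
      rw [Finset.sum_filter_of_ne]
      intro j _ hj h0
      exact hj (by rw [h0, mul_zero])
    rw [e]
    calc ‖∑ j ∈ F with T j B ≠ 0, c j * T j B‖ ^ 2
        ≤ (∑ j ∈ F with T j B ≠ 0, ‖c j * T j B‖) ^ 2 := by gcongr; exact norm_sum_le _ _
      _ ≤ (Finset.card {j ∈ F | T j B ≠ 0}) * ∑ j ∈ F with T j B ≠ 0, ‖c j * T j B‖ ^ 2 :=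
          sq_sum_le_card_mul_sum_sq
      _ ≤ n * ∑ j ∈ F, ‖c j‖ ^ 2 * ‖T j B‖ ^ 2 := by
          simp only [norm_mul, mul_pow]
          gcongr
          · exact hn B _ fun j hj => (Finset.mem_filter.1 hj).2
          · exact Finset.filter_subset _ _
  · rw [mul_assoc, Finset.mul_sum _ _ (D ^ 2)]
    refine mul_le_mul_of_nonneg_left (Finset.sum_le_sum fun j _ => ?_) (Nat.cast_nonneg _)
    rw [mul_comm (D ^ 2)]
    gcongr
    exact hD j

/-! ### Locality of the fermionic bilinears -/

section Fock

variable {I : Type} [LinearOrder I]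

theorem norm_jwSign (i : I) (A : Finset I) : ‖jwSign i A‖ = 1 := by simp [jwSign]

/-- The `ℓ¹`-norm of a finite combination. -/
noncomputable def finsuppL1 {α : Type*} (x : α →₀ ℂ) : ℝ := x.sum fun _ c => ‖c‖

theorem finsuppL1_nonneg {α : Type*} (x : α →₀ ℂ) : 0 ≤ finsuppL1 x :=
  Finset.sum_nonneg fun _ _ => norm_nonneg _

theorem finsuppL1_eq {α : Type*} (x : α →₀ ℂ) {s : Finset α} (hs : x.support ⊆ s) :
    finsuppL1 x = ∑ a ∈ s, ‖x a‖ :=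
  Finsupp.sum_of_support_subset x hs _ fun _ _ => norm_zero

@[simp] theorem finsuppL1_zero {α : Type*} : finsuppL1 (0 : α →₀ ℂ) = 0 := by
  simp [finsuppL1]

@[simp] theorem finsuppL1_single {α : Type*} (a : α) (c : ℂ) :
    finsuppL1 (Finsupp.single a c) = ‖c‖ := by simp [finsuppL1]

theorem finsuppL1_add_le {α : Type*} (x y : α →₀ ℂ) :
    finsuppL1 (x + y) ≤ finsuppL1 x + finsuppL1 y := by
  classical
  rw [finsuppL1_eq (x + y) Finsupp.support_add, finsuppL1_eq x Finset.subset_union_left,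
    finsuppL1_eq y Finset.subset_union_right, ← Finset.sum_add_distrib]
  exact Finset.sum_le_sum fun a _ => norm_add_le _ _

theorem finsuppL1_smul_le {α : Type*} (c : ℂ) (x : α →₀ ℂ) :
    finsuppL1 (c • x) ≤ ‖c‖ * finsuppL1 x := by
  rw [finsuppL1_eq (c • x) Finsupp.support_smul, finsuppL1_eq x subset_rfl, Finset.mul_sum]
  exact Finset.sum_le_sum fun a _ => by simp

theorem finsuppL1_neg {α : Type*} (x : α →₀ ℂ) : finsuppL1 (-x) = finsuppL1 x := by
  rw [finsuppL1_eq (-x) (by rw [Finsupp.support_neg]), finsuppL1_eq x subset_rfl]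
  simp

theorem finsuppL1_sum_le {α ι : Type*} (s : Finset ι) (x : ι → α →₀ ℂ) :
    finsuppL1 (∑ i ∈ s, x i) ≤ ∑ i ∈ s, finsuppL1 (x i) :=
  Finset.le_sum_of_subadditive _ finsuppL1_zero.le finsuppL1_add_le _ _

theorem finsuppL1_linearCombination_le {α β : Type*} (f : α → β →₀ ℂ) (D : ℝ)
    (hf : ∀ a, finsuppL1 (f a) ≤ D) (x : α →₀ ℂ) :
    finsuppL1 (Finsupp.linearCombination ℂ f x) ≤ finsuppL1 x * D := by
  rw [Finsupp.linearCombination_apply, Finsupp.sum]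
  refine (finsuppL1_sum_le _ _).trans ?_
  rw [finsuppL1, Finsupp.sum, Finset.sum_mul]
  refine Finset.sum_le_sum fun a _ => (finsuppL1_smul_le _ _).trans ?_
  gcongr
  exact hf a

/-! ### Creation and annihilation operators: `ℓ¹` bounds and supports. -/

theorem create_apply (ξ : I →₀ ℂ) (Φ : FockAlg I) :
    create ξ Φ = ξ.sum fun i c => c • create1 i Φ := by
  simp [create, Finsupp.sum, LinearMap.sum_apply]

theorem annih_apply (ξ : I →₀ ℂ) (Φ : FockAlg I) :
    annih ξ Φ = ξ.sum fun i c => starRingEnd ℂ c • annih1 i Φ := by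
  simp [annih, Finsupp.sum, LinearMap.sum_apply]

theorem finsuppL1_create1_le (i : I) (Φ : FockAlg I) : finsuppL1 (create1 i Φ) ≤ finsuppL1 Φ := by
  refine (finsuppL1_linearCombination_le _ 1 (fun A => ?_) Φ).trans_eq (mul_one _)
  split_ifs <;> simp [norm_jwSign]

theorem finsuppL1_annih1_le (i : I) (Φ : FockAlg I) : finsuppL1 (annih1 i Φ) ≤ finsuppL1 Φ := by
  refine (finsuppL1_linearCombination_le _ 1 (fun A => ?_) Φ).trans_eq (mul_one _)
  split_ifs <;> simp [norm_jwSign]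

theorem finsuppL1_create_le (ξ : I →₀ ℂ) (Φ : FockAlg I) :
    finsuppL1 (create ξ Φ) ≤ finsuppL1 ξ * finsuppL1 Φ := by
  rw [create_apply]
  exact finsuppL1_linearCombination_le (fun i => create1 i Φ) _ (fun i => finsuppL1_create1_le i Φ) ξ

theorem finsuppL1_annih_le (ξ : I →₀ ℂ) (Φ : FockAlg I) :
    finsuppL1 (annih ξ Φ) ≤ finsuppL1 ξ * finsuppL1 Φ := by
  rw [annih_apply, Finsupp.sum]
  refine (finsuppL1_sum_le _ _).trans ?_
  rw [finsuppL1, Finsupp.sum, Finset.sum_mul]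
  refine Finset.sum_le_sum fun i _ => (finsuppL1_smul_le _ _).trans ?_
  rw [RCLike.norm_conj]
  gcongr
  exact finsuppL1_annih1_le i Φ

theorem toFock_apply (Φ : FockAlg I) (B : Finset I) : (toFock Φ : Fock I) B = Φ B := by
  classical
  rw [toFock, Finsupp.linearCombination_apply, Finsupp.sum, lp.coeFn_sum, Finset.sum_apply]
  simp only [lp.coeFn_smul, Pi.smul_apply, lp.single_apply, smul_eq_mul]
  simp [Pi.single_apply, eq_comm]

theorem norm_toFock_le (Φ : FockAlg I) : ‖toFock Φ‖ ≤ finsuppL1 Φ := by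
  rw [toFock, Finsupp.linearCombination_apply]
  refine (norm_sum_le _ _).trans (Finset.sum_le_sum fun A _ => ?_)
  rw [norm_smul, lp.norm_single (by simp)]
  simp

theorem exists_of_create1_apply_ne_zero {i : I} {Φ : FockAlg I} {B : Finset I}
    (h : create1 i Φ B ≠ 0) : i ∈ B ∧ Φ (B.erase i) ≠ 0 := by
  rw [create1, Finsupp.linearCombination_apply, Finsupp.sum, Finsupp.finsetSum_apply] at h
  obtain ⟨A, hA, h⟩ := Finset.exists_ne_zero_of_sum_ne_zero h
  split_ifs at h with hi
  · simp at h
  · have : insert i A = B := by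
      by_contra hne
      exact h (by simp [Finsupp.single_eq_of_ne' hne])
    subst this
    rw [Finset.erase_insert hi]
    exact ⟨Finset.mem_insert_self _ _, Finsupp.mem_support_iff.1 hA⟩

theorem exists_of_annih1_apply_ne_zero {i : I} {Φ : FockAlg I} {B : Finset I}
    (h : annih1 i Φ B ≠ 0) : i ∉ B ∧ Φ (insert i B) ≠ 0 := by
  rw [annih1, Finsupp.linearCombination_apply, Finsupp.sum, Finsupp.finsetSum_apply] at h
  obtain ⟨A, hA, h⟩ := Finset.exists_ne_zero_of_sum_ne_zero h
  split_ifs at h with hi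
  · have : A.erase i = B := by
      by_contra hne
      exact h (by simp [Finsupp.single_eq_of_ne' hne])
    subst this
    rw [Finset.insert_erase hi]
    exact ⟨Finset.notMem_erase _ _, Finsupp.mem_support_iff.1 hA⟩
  · simp at h

theorem exists_of_create_apply_ne_zero {ξ : I →₀ ℂ} {Φ : FockAlg I} {B : Finset I}
    (h : create ξ Φ B ≠ 0) : ∃ i, ξ i ≠ 0 ∧ i ∈ B ∧ Φ (B.erase i) ≠ 0 := by
  rw [create_apply, Finsupp.sum, Finsupp.finsetSum_apply] at h
  obtain ⟨i, hi, h⟩ := Finset.exists_ne_zero_of_sum_ne_zero h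
  rw [Finsupp.smul_apply, smul_ne_zero_iff] at h
  exact ⟨i, h.1, exists_of_create1_apply_ne_zero h.2⟩

theorem exists_of_annih_apply_ne_zero {ξ : I →₀ ℂ} {Φ : FockAlg I} {B : Finset I}
    (h : annih ξ Φ B ≠ 0) : ∃ i, ξ i ≠ 0 ∧ i ∉ B ∧ Φ (insert i B) ≠ 0 := by
  rw [annih_apply, Finsupp.sum, Finsupp.finsetSum_apply] at h
  obtain ⟨i, hi, h⟩ := Finset.exists_ne_zero_of_sum_ne_zero h
  rw [Finsupp.smul_apply, smul_ne_zero_iff] at h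
  exact ⟨i, Finsupp.mem_support_iff.1 hi, exists_of_annih1_apply_ne_zero h.2⟩

/-- The representation maps the plane wave of index `j` to vectors of label `j`, to a particle only
if `τ j ≥ 0` and to an antiparticle only if `τ j ≤ 0`. -/
structure QuasiFreeRep.IsLocal (ρ : QuasiFreeRep I) (τ : Chirality) (label : I → ℤ) : Prop where
  v_ne_zero : ∀ j i, ρ.v (Finsupp.single j 1) i ≠ 0 → label i = j ∧ 0 ≤ τ.sgn * j
  w_ne_zero : ∀ j i, ρ.w (Finsupp.single j 1) i ≠ 0 → label i = j ∧ τ.sgn * j ≤ 0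
  v_le : ∀ j, finsuppL1 (ρ.v (Finsupp.single j 1)) ≤ 1
  w_le : ∀ j, finsuppL1 (ρ.w (Finsupp.single j 1)) ≤ 1

variable {ρ : QuasiFreeRep I} {τ : Chirality} {label : I → ℤ}

theorem single_apply_ne_zero {A B : Finset I}
    (h : (Finsupp.single A (1 : ℂ) : FockAlg I) B ≠ 0) : B = A := by
  by_contra hne
  exact h (Finsupp.single_eq_of_ne hne)

/-- One of the four normal-ordered terms must be nonzero at `B`. What it creates ends up in `B` and
what it annihilates comes from `A`, so both momenta are labels of `A ∪ B`. Only the term with two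
creators annihilates nothing in `A`; there the locality of `v` and `w` forces the signs of the last
alternative. -/
theorem QuasiFreeRep.IsLocal.of_apply_ne_zero (hρ : ρ.IsLocal τ label) {A B : Finset I} {p q : ℤ}
    (h : normalOrdered ρ (Finsupp.single p 1) (Finsupp.single q 1) (Finsupp.single A 1) B ≠ 0) :
    p ∈ (A ∪ B).image label ∧ q ∈ (A ∪ B).image label ∧ B.card ≤ A.card + 2 ∧
      (p ∈ A.image label ∨ q ∈ A.image label ∨ (0 ≤ τ.sgn * p ∧ τ.sgn * q ≤ 0)) := by
  have h4 : (create (ρ.v (Finsupp.single p 1))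
        (annih (ρ.v (Finsupp.single q 1)) (Finsupp.single A 1)) B ≠ 0 ∨
      create (ρ.v (Finsupp.single p 1))
        (create (ρ.w (Finsupp.single q 1)) (Finsupp.single A 1)) B ≠ 0) ∨
      annih (ρ.w (Finsupp.single p 1))
        (annih (ρ.v (Finsupp.single q 1)) (Finsupp.single A 1)) B ≠ 0 ∨
      create (ρ.w (Finsupp.single q 1))
        (annih (ρ.w (Finsupp.single p 1)) (Finsupp.single A 1)) B ≠ 0 := by
    by_contra! hc
    apply h
    simp only [normalOrdered, LinearMap.add_apply, LinearMap.sub_apply, LinearMap.comp_apply,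
      Finsupp.add_apply, Finsupp.sub_apply, hc.1.1, hc.1.2, hc.2.1, hc.2.2]
    simp
  rcases h4 with (h | h) | h | h
  · obtain ⟨i, hi, hiB, h⟩ := exists_of_create_apply_ne_zero h
    obtain ⟨i', hi', -, h⟩ := exists_of_annih_apply_ne_zero h
    have hA := single_apply_ne_zero h
    obtain ⟨rfl, -⟩ := hρ.v_ne_zero _ _ hi
    obtain ⟨rfl, -⟩ := hρ.v_ne_zero _ _ hi'
    have hA' : i' ∈ A := by rw [← hA]; exact Finset.mem_insert_self _ _
    refine ⟨Finset.mem_image_of_mem _ (Finset.mem_union_right _ hiB),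
      Finset.mem_image_of_mem _ (Finset.mem_union_left _ hA'), ?_,
      .inr (.inl (Finset.mem_image_of_mem _ hA'))⟩
    have := Finset.card_le_card (Finset.subset_insert i' (B.erase i))
    rw [hA] at this
    have := Finset.card_erase_add_one hiB
    omega
  · obtain ⟨i, hi, hiB, h⟩ := exists_of_create_apply_ne_zero h
    obtain ⟨i', hi', hiB', h⟩ := exists_of_create_apply_ne_zero h
    have hA := single_apply_ne_zero h
    obtain ⟨rfl, h1⟩ := hρ.v_ne_zero _ _ hi
    obtain ⟨rfl, h2⟩ := hρ.w_ne_zero _ _ hi'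
    refine ⟨Finset.mem_image_of_mem _ (Finset.mem_union_right _ hiB),
      Finset.mem_image_of_mem _ (Finset.mem_union_right _ (Finset.mem_of_mem_erase hiB')), ?_,
      .inr (.inr ⟨h1, h2⟩)⟩
    have := Finset.card_erase_add_one hiB
    have := Finset.card_erase_add_one hiB'
    rw [hA] at this
    omega
  · obtain ⟨i, hi, hiB, h⟩ := exists_of_annih_apply_ne_zero h
    obtain ⟨i', hi', hiB', h⟩ := exists_of_annih_apply_ne_zero h
    have hA := single_apply_ne_zero h
    obtain ⟨rfl, h1⟩ := hρ.w_ne_zero _ _ hi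
    obtain ⟨rfl, h2⟩ := hρ.v_ne_zero _ _ hi'
    have hA1 : i ∈ A := by rw [← hA]; simp
    have hA2 : i' ∈ A := by rw [← hA]; simp
    refine ⟨Finset.mem_image_of_mem _ (Finset.mem_union_left _ hA1),
      Finset.mem_image_of_mem _ (Finset.mem_union_left _ hA2), ?_,
      .inl (Finset.mem_image_of_mem _ hA1)⟩
    have : B ⊆ A := by
      rw [← hA]
      exact (Finset.subset_insert _ _).trans (Finset.subset_insert _ _)
    have := Finset.card_le_card this
    omega
  · obtain ⟨i, hi, hiB, h⟩ := exists_of_create_apply_ne_zero h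
    obtain ⟨i', hi', -, h⟩ := exists_of_annih_apply_ne_zero h
    have hA := single_apply_ne_zero h
    obtain ⟨rfl, -⟩ := hρ.w_ne_zero _ _ hi
    obtain ⟨rfl, -⟩ := hρ.w_ne_zero _ _ hi'
    have hA' : i' ∈ A := by rw [← hA]; exact Finset.mem_insert_self _ _
    refine ⟨Finset.mem_image_of_mem _ (Finset.mem_union_left _ hA'),
      Finset.mem_image_of_mem _ (Finset.mem_union_right _ hiB), ?_,
      .inl (Finset.mem_image_of_mem _ hA')⟩
    have := Finset.card_le_card (Finset.subset_insert i' (B.erase i))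
    rw [hA] at this
    have := Finset.card_erase_add_one hiB
    omega

theorem QuasiFreeRep.IsLocal.finsuppL1_normalOrdered_le (hρ : ρ.IsLocal τ label) (A : Finset I)
    (p q : ℤ) : finsuppL1 (normalOrdered ρ (Finsupp.single p 1) (Finsupp.single q 1)
      (Finsupp.single A 1)) ≤ 4 := by
  have hc : ∀ {ξ : I →₀ ℂ} {Φ : FockAlg I}, finsuppL1 ξ ≤ 1 → finsuppL1 Φ ≤ 1 →
      finsuppL1 (create ξ Φ) ≤ 1 := fun h1 h2 =>
    (finsuppL1_create_le _ _).trans (mul_le_one₀ h1 (finsuppL1_nonneg _) h2)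
  have ha : ∀ {ξ : I →₀ ℂ} {Φ : FockAlg I}, finsuppL1 ξ ≤ 1 → finsuppL1 Φ ≤ 1 →
      finsuppL1 (annih ξ Φ) ≤ 1 := fun h1 h2 =>
    (finsuppL1_annih_le _ _).trans (mul_le_one₀ h1 (finsuppL1_nonneg _) h2)
  have h0 : finsuppL1 (Finsupp.single A (1 : ℂ)) ≤ 1 := by simp
  simp only [normalOrdered, LinearMap.add_apply, LinearMap.sub_apply, LinearMap.comp_apply]
  rw [sub_eq_add_neg]
  refine (finsuppL1_add_le _ _).trans ?_
  rw [finsuppL1_neg]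
  have h1 := finsuppL1_add_le (create (ρ.v (Finsupp.single p 1))
      (annih (ρ.v (Finsupp.single q 1)) (Finsupp.single A 1)) + create (ρ.v (Finsupp.single p 1))
        (create (ρ.w (Finsupp.single q 1)) (Finsupp.single A 1)))
      (annih (ρ.w (Finsupp.single p 1)) (annih (ρ.v (Finsupp.single q 1)) (Finsupp.single A 1)))
  have h2 := finsuppL1_add_le (create (ρ.v (Finsupp.single p 1))
      (annih (ρ.v (Finsupp.single q 1)) (Finsupp.single A 1))) (create (ρ.v (Finsupp.single p 1))
        (create (ρ.w (Finsupp.single q 1)) (Finsupp.single A 1)))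
  have h3 := hc (hρ.v_le p) (ha (hρ.v_le q) h0)
  have h4 := hc (hρ.v_le p) (hc (hρ.w_le q) h0)
  have h5 := ha (hρ.w_le p) (ha (hρ.v_le q) h0)
  have h6 := hc (hρ.w_le q) (ha (hρ.w_le p) h0)
  linarith

/-- The multiplicity is the number of pairs of labels from `A ∪ B`, a set of at most `|A| + (|A| +
2)` elements. -/
theorem QuasiFreeRep.IsLocal.isBessel_single (hρ : ρ.IsLocal τ label) (A : Finset I) :
    IsBessel fun pq : ℤ × ℤ => toFock (normalOrdered ρ (Finsupp.single pq.1 1)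
      (Finsupp.single pq.2 1) (Finsupp.single A 1)) := by
  refine isBessel_of_multiplicity _ 4 ((2 * A.card + 2) * (2 * A.card + 2))
    (fun pq => (norm_toFock_le _).trans (hρ.finsuppL1_normalOrdered_le A _ _)) fun B F hF => ?_
  simp only [toFock_apply] at hF
  rcases F.eq_empty_or_nonempty with rfl | ⟨x, hx⟩
  · simp
  have hB := (hρ.of_apply_ne_zero (hF x hx)).2.2.1
  have hcard : ((A ∪ B).image label).card ≤ 2 * A.card + 2 := by
    have := Finset.card_image_le (s := A ∪ B) (f := label)
    have := Finset.card_union_le A B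
    omega
  calc F.card ≤ ((A ∪ B).image label ×ˢ (A ∪ B).image label).card :=
        Finset.card_le_card fun y hy => by
          have := hρ.of_apply_ne_zero (hF y hy)
          exact Finset.mem_product.2 ⟨this.1, this.2.1⟩
    _ ≤ _ := by
        rw [Finset.card_product]
        exact Nat.mul_le_mul hcard hcard

theorem QuasiFreeRep.IsLocal.isBessel (hρ : ρ.IsLocal τ label) (Φ : FockAlg I) :
    IsBessel fun kl : ℤ × ℤ => toFock (normalOrdered ρ (Finsupp.single (kl.2 - τ.sgn * kl.1) 1)
      (Finsupp.single kl.2 1) Φ) := by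
  -- Since `τ = ±1`, the two momenta of a bilinear determine `k`.
  have hinj : Function.Injective fun kl : ℤ × ℤ => (kl.2 - τ.sgn * kl.1, kl.2) := by
    rintro ⟨k, l⟩ ⟨k', l'⟩ h
    simp only [Prod.mk.injEq] at h
    obtain ⟨h, rfl⟩ := h
    cases τ <;> simp [Chirality.sgn] at h ⊢ <;> omega
  induction Φ using Finsupp.induction_linear with
  | zero => simpa using IsBessel.zero
  | add x y hx hy => simpa using hx.add hy
  | single A c =>
    have := ((hρ.isBessel_single A).comp_injective hinj).const_smul c
    simpa [← map_smul] using this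

/-- Either `l - τk` or `l` is one of the finitely many labels occurring in `Φ`, or a pair is
created. In the last case `0 ≤ τ(l - τk) = τl - k` and `τl ≤ 0`, hence `k ≤ τl ≤ 0` and `|l| ≤ |k|`.
-/
theorem QuasiFreeRep.IsLocal.exists_eq_zero (hρ : ρ.IsLocal τ label) (Φ : FockAlg I) :
    ∃ R : ℤ, ∀ k l : ℤ, R + |k| < |l| → normalOrdered ρ (Finsupp.single (l - τ.sgn * k) 1)
      (Finsupp.single l 1) Φ = 0 := by
  induction Φ using Finsupp.induction_linear with
  | zero => exact ⟨0, fun k l _ => map_zero _⟩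
  | add x y hx hy =>
    obtain ⟨R, hR⟩ := hx
    obtain ⟨R', hR'⟩ := hy
    refine ⟨max R R', fun k l h => ?_⟩
    rw [map_add, hR k l (by have := le_max_left R R'; omega),
      hR' k l (by have := le_max_right R R'; omega), add_zero]
  | single A c =>
    obtain ⟨R, hR⟩ : ∃ R : ℤ, ∀ i ∈ A, |label i| ≤ R := by
      obtain ⟨R, hR⟩ := (A.image fun i => |label i|).bddAbove
      exact ⟨R, fun i hi => hR (Finset.mem_coe.2 (Finset.mem_image_of_mem _ hi))⟩
    -- The bound must be nonnegative for pair creation, which gives only `|l| ≤ |k|`.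
    refine ⟨max R 0, fun k l h => ?_⟩
    rw [← Finsupp.smul_single_one A, map_smul, smul_eq_zero]
    right
    ext B
    by_contra hne
    have hR0 := le_max_left R 0
    have hR1 := le_max_right R 0
    generalize max R 0 = R' at *
    have hk : |τ.sgn * k| = |k| := by cases τ <;> simp [Chirality.sgn]
    rcases (hρ.of_apply_ne_zero hne).2.2.2 with h1 | h1 | ⟨h1, h2⟩
    · obtain ⟨i, hi, h1⟩ := Finset.mem_image.1 h1
      have := hR i hi
      rw [h1] at this
      have h3 := abs_add_le (l - τ.sgn * k) (τ.sgn * k)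
      rw [sub_add_cancel, hk] at h3
      omega
    · obtain ⟨i, hi, h1⟩ := Finset.mem_image.1 h1
      have := hR i hi
      rw [h1] at this
      have := abs_nonneg k
      omega
    · cases τ <;> simp [Chirality.sgn] at h1 h2 <;> grind

/-! ### Homogeneity of the bilinears. -/

theorem create_smul (c : ℂ) (ξ : I →₀ ℂ) : create (c • ξ) = c • create ξ := by
  rw [create, Finsupp.sum_smul_index (by simp), create, Finsupp.smul_sum]
  simp [mul_smul]

theorem annih_smul (c : ℂ) (ξ : I →₀ ℂ) : annih (c • ξ) = starRingEnd ℂ c • annih ξ := by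
  rw [annih, Finsupp.sum_smul_index (by simp), annih, Finsupp.smul_sum]
  simp [mul_smul]

theorem normalOrdered_smul (ρ : QuasiFreeRep I) (a b : ℝ) (ξ η : ℤ →₀ ℂ) :
    normalOrdered ρ ((a : ℂ) • ξ) ((b : ℂ) • η) = ((a * b : ℝ) : ℂ) • normalOrdered ρ ξ η := by
  refine LinearMap.ext fun Φ => ?_
  simp only [normalOrdered, map_smul, LinearMap.map_smulₛₗ, create_smul, annih_smul,
    Complex.conj_ofReal, LinearMap.smul_apply, LinearMap.add_apply, LinearMap.sub_apply,
    LinearMap.comp_apply]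
  push_cast
  module

end Fock

/-! ### Locality of the Neveu-Schwarz and Ramond representations -/

theorem finsuppL1_conjJ {I : Type} (x : I →₀ ℂ) : finsuppL1 (conjJ I x) = finsuppL1 x := by
  rw [finsuppL1_eq (conjJ I x) (s := x.support)
    (Finsupp.support_mapRange (hf := map_zero _)), finsuppL1_eq x subset_rfl]
  exact Finset.sum_congr rfl fun i _ => by simp [conjJ]

theorem isLocal_repNS (τ : Chirality) : (repNS τ).IsLocal τ id := by
  have hv : ∀ (σ : Chirality) (j i : ℤ), hardy σ (Finsupp.single j 1) i ≠ 0 →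
      i = j ∧ 0 ≤ σ.sgn * j := by
    intro σ j i h
    rw [hardy, Finsupp.linearCombination_single, one_smul] at h
    split_ifs at h with hj
    · refine ⟨?_, ?_⟩
      · by_contra hne
        exact h (Finsupp.single_eq_of_ne hne)
      -- The momentum is a multiple of `j + 1/2`: it is positive for `j ≥ 0` and negative for `j ≤
      -- -1`.
      · cases σ <;> simp only [Chirality.sgn, Sector.shift] at hj ⊢ <;> push_cast at hj
        · have : (-1 : ℝ) < j := by linarith
          have : (-1 : ℤ) < j := by exact_mod_cast this
          omega
        · have : (j : ℝ) < 0 := by linarith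
          have : j < 0 := by exact_mod_cast this
          omega
    · simp at h
  have hv1 : ∀ (σ : Chirality) (j : ℤ), finsuppL1 (hardy σ (Finsupp.single j 1)) ≤ 1 := by
    intro σ j
    rw [hardy, Finsupp.linearCombination_single, one_smul]
    split_ifs <;> simp
  refine ⟨hv τ, fun j i h => ?_, hv1 τ, fun j => ?_⟩
  · have := hv τ.opp j i fun h0 => h (by simp [repNS, conjJ, h0])
    refine ⟨this.1, ?_⟩
    have := this.2
    cases τ <;> simp [Chirality.sgn, Chirality.opp] at this ⊢ <;> omega
  · exact (finsuppL1_conjJ _).trans_le (hv1 _ j)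

theorem isLocal_repR (τ : Chirality) : (repR τ).IsLocal τ fun i => (ofLex i).1 := by
  have hd : ∀ (j : ℤ) (c : Fin 2) (i : Doubled), dbl j c i ≠ 0 → (ofLex i).1 = j := by
    intro j c i h
    by_contra hne
    refine h (Finsupp.single_eq_of_ne ?_)
    rintro rfl
    exact hne rfl
  have hv : ∀ (σ : Chirality) (j : ℤ) (i : Doubled), doubledProj σ (Finsupp.single j 1) i ≠ 0 →
      (ofLex i).1 = j ∧ 0 ≤ σ.sgn * j := by
    intro σ j i h
    rw [doubledProj, Finsupp.linearCombination_single, one_smul] at h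
    split_ifs at h with hj hj'
    · subst hj
      refine ⟨?_, by simp⟩
      by_contra hne
      have h0 : ∀ c, dbl 0 c i = 0 := fun c => by
        by_contra hc
        exact hne (hd 0 c i hc)
      exact h (by simp [h0])
    · exact ⟨hd j 0 i h, hj'.le⟩
    · simp at h
  have hv1 : ∀ (σ : Chirality) (j : ℤ), finsuppL1 (doubledProj σ (Finsupp.single j 1)) ≤ 1 := by
    intro σ j
    rw [doubledProj, Finsupp.linearCombination_single, one_smul]
    split_ifs
    -- At zero momentum the projection has two entries of modulus `1/2`.
    · refine (finsuppL1_add_le _ _).trans ?_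
      have h1 := finsuppL1_smul_le (1 / 2) (dbl 0 0)
      have h2 := finsuppL1_smul_le ((σ.sgn : ℂ) / 2) (dbl 0 1)
      have h3 : ∀ c, finsuppL1 (dbl 0 c) = 1 := fun c => by simp [dbl]
      have h4 : ‖(σ.sgn : ℂ) / 2‖ = 1 / 2 := by cases σ <;> simp [Chirality.sgn]
      rw [h3] at h1 h2
      rw [h4] at h2
      norm_num at h1 h2 ⊢
      linarith
    · simp [dbl]
    · simp
  refine ⟨hv τ, fun j i h => ?_, hv1 τ, fun j => ?_⟩
  · have := hv τ.opp j i fun h0 => h (by simp [repR, conjJ, h0])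
    refine ⟨this.1, ?_⟩
    have := this.2
    cases τ <;> simp [Chirality.sgn, Chirality.opp] at this ⊢ <;> omega
  · exact (finsuppL1_conjJ _).trans_le (hv1 _ j)

/-! ### The low-pass filter and the two-scale equation -/

section Wavelet

open MeasureTheory FourierTransform

variable {K : ℕ} {h : Fin (2 * K) → ℝ} {s : ℝ → ℝ}

theorem lowPass_add_two_pi_mul (h : Fin (2 * K) → ℝ) (l : ℝ) (m : ℤ) :
    lowPass h (l + 2 * Real.pi * m) = lowPass h l := by
  unfold lowPass
  congr 1
  refine Finset.sum_congr rfl fun n _ => ?_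
  congr 1
  rw [Complex.exp_eq_exp_iff_exists_int]
  refine ⟨-(m * ((n : ℕ) : ℤ)), ?_⟩
  push_cast
  ring

/-! ### Lattice momenta, reduction to the Brillouin zone and the iterated filter. -/

theorem Geometry.num_pos (g : Geometry) (N : ℕ) : 0 < g.num N :=
  Nat.mul_pos (by positivity) g.L0_pos

theorem Geometry.eps_pos (g : Geometry) (N : ℕ) : 0 < g.eps N :=
  div_pos g.eps0_pos (by positivity)

theorem Geometry.L_pos (g : Geometry) : 0 < g.L :=
  mul_pos g.eps0_pos (Nat.cast_pos.2 g.L0_pos)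

theorem Geometry.eps_mul_num (g : Geometry) (N : ℕ) : g.eps N * g.num N = g.L := by
  simp only [eps, num, L]
  push_cast
  field_simp

theorem Geometry.eps_succ (g : Geometry) (N : ℕ) : g.eps (N + 1) = g.eps N / 2 := by
  simp only [eps, pow_succ]
  field_simp

theorem Geometry.tendsto_eps (g : Geometry) : Tendsto g.eps atTop (𝓝 0) := by
  have := (tendsto_pow_atTop_nhds_zero_of_lt_one (r := (1 / 2 : ℝ)) (by norm_num)
    (by norm_num)).const_mul g.eps0
  rw [mul_zero] at this
  refine this.congr fun N => ?_
  rw [Geometry.eps, one_div, inv_pow, div_eq_mul_inv]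

theorem eps_mul_loopMom (g : Geometry) (N : ℕ) (j : ℤ) :
    g.eps N * loopMom g j = Real.pi * j / g.num N := by
  have := g.L_pos
  have h1 : (0 : ℝ) < g.num N := Nat.cast_pos.2 (g.num_pos N)
  rw [loopMom, mom, Sector.shift, ← g.eps_mul_num N]
  have := g.eps_pos N
  field_simp
  ring

theorem lowPass_eps_mul_loopMom_congr (g : Geometry) (h : Fin (2 * K) → ℝ) (N : ℕ) {i j : ℤ}
    (hij : 2 * (g.num N : ℤ) ∣ i - j) :
    lowPass h (g.eps N * loopMom g i) = lowPass h (g.eps N * loopMom g j) := by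
  obtain ⟨m, hm⟩ := hij
  obtain rfl : i = j + 2 * (g.num N : ℤ) * m := by omega
  have h1 : (0 : ℝ) < g.num N := Nat.cast_pos.2 (g.num_pos N)
  rw [← lowPass_add_two_pi_mul h (g.eps N * loopMom g j) m]
  congr 1
  rw [eps_mul_loopMom, eps_mul_loopMom]
  push_cast
  field_simp

theorem Geometry.dvd_red_sub (g : Geometry) (N : ℕ) (j : ℤ) :
    2 * (g.num N : ℤ) ∣ g.red N j - j := by
  rw [Geometry.red, Int.emod_def]
  exact ⟨-((j + g.num N) / (2 * g.num N)), by ring⟩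

theorem Geometry.num_dvd (g : Geometry) {N N' : ℕ} (hN : N ≤ N') :
    (2 * (g.num N : ℤ)) ∣ 2 * (g.num N' : ℤ) := by
  refine mul_dvd_mul_left 2 (Int.natCast_dvd_natCast.2 ?_)
  exact Nat.mul_dvd_mul_right (pow_dvd_pow 2 hN) _

theorem Geometry.red_congr (g : Geometry) (N : ℕ) {i j : ℤ} (hij : 2 * (g.num N : ℤ) ∣ i - j) :
    g.red N i = g.red N j := by
  rw [Geometry.red, Geometry.red]
  congr 1
  refine (Int.emod_emod_of_dvd _ dvd_rfl).symm.trans ?_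
  rw [Int.emod_emod_of_dvd _ dvd_rfl, Int.emod_eq_emod_iff_emod_sub_eq_zero]
  rw [add_sub_add_right_eq_sub]
  exact Int.emod_eq_zero_of_dvd hij

theorem Geometry.red_mem_zone (g : Geometry) (N : ℕ) (j : ℤ) : g.red N j ∈ g.zone N := by
  have := g.num_pos N
  have h1 := Int.emod_nonneg (j + g.num N) (b := 2 * (g.num N : ℤ)) (by omega)
  have h2 := Int.emod_lt_of_pos (j + g.num N) (b := 2 * (g.num N : ℤ)) (by omega)
  simp only [Geometry.red, Geometry.zone, Finset.mem_Ico]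
  omega

/-- The periods `2 L_N` divide one another, so reduction at a finer scale changes neither the filter
values of the coarser scales nor the final reduction at scale `M`. At least one step is needed,
because without any step `Y` is not periodized. -/
theorem loopScale_succ_eq (g : Geometry) (h : Fin (2 * K) → ℝ) (M d : ℕ) (Y : ℤ → ℂ) (j : ℤ) :
    loopScale g h M (d + 1) Y j =
      2 ^ (d + 1) * (∏ i ∈ Finset.range (d + 1), lowPass h (g.eps (M + i + 1) * loopMom g j)) *
        Y (g.red M j) := by
  induction d generalizing j with
  | zero => simp [loopScale, loopStep]
  | succ d ih =>
    rw [loopScale, loopStep, ih, Finset.prod_range_succ _ (d + 1),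
      g.red_congr M ((g.num_dvd (by omega)).trans (g.dvd_red_sub (M + (d + 1)) j))]
    rw [Finset.prod_congr rfl fun i hi => lowPass_eps_mul_loopMom_congr g h (M + i + 1)
      ((g.num_dvd (by have := Finset.mem_range.1 hi; omega)).trans (g.dvd_red_sub (M + (d + 1)) j))]
    rw [← add_assoc M d 1]
    ring

/-! ### Fourier transform of the scaling function. -/

theorem scalingHat_eq_fourier (s : ℝ → ℝ) (l : ℝ) :
    scalingHat s l = 𝓕 (fun x => (s x : ℂ)) (l / (2 * Real.pi)) := by
  rw [Real.fourier_eq', scalingHat]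
  refine integral_congr_ae (.of_forall fun x => ?_)
  simp only [smul_eq_mul]
  congr 2
  simp
  field_simp

theorem continuous_scalingHat (hs : Integrable s) : Continuous (scalingHat s) := by
  have h1 : Continuous (𝓕 (fun x => (s x : ℂ))) :=
    VectorFourier.fourierIntegral_continuous Real.continuous_fourierChar
      (by exact continuous_inner) hs.ofReal
  rw [show scalingHat s = fun l => 𝓕 (fun x => (s x : ℂ)) (l / (2 * Real.pi)) from
    funext (scalingHat_eq_fourier s)]
  exact h1.comp (continuous_id.div_const _)

theorem IsDaubechies.integrable (hs : IsDaubechies K h s) (hreg : ContDiff ℝ 2 s) :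
    Integrable s := hreg.continuous.integrable_of_hasCompactSupport hs.compactSupport

theorem IsDaubechies.scalingHat_zero (hs : IsDaubechies K h s) : scalingHat s 0 = 1 := by
  have : scalingHat s 0 = ∫ x, ((s x : ℝ) : ℂ) := by simp [scalingHat]
  rw [this, integral_complex_ofReal, hs.integral_eq_one, Complex.ofReal_one]

/-- Fourier transform of the refinement equation: substituting `y = 2x - n` gives a Jacobian `1/2`
and a phase `e^{-iln/2}`, and `√2 / 2 = 1 / √2` is the normalization of `m₀`. -/
theorem IsDaubechies.scalingHat_two_scale (hs : IsDaubechies K h s) (hreg : ContDiff ℝ 2 s)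
    (l : ℝ) : scalingHat s l = lowPass h (l / 2) * scalingHat s (l / 2) := by
  have hint := hs.integrable hreg
  have h2 : (√2 : ℝ) ≠ 0 := by positivity
  have hE : ∀ (f : ℝ → ℝ), Integrable f → Integrable fun x : ℝ =>
      Complex.exp (-(Complex.I * (l : ℂ) * (x : ℂ))) * (f x : ℂ) := by
    intro f hf
    refine hf.ofReal.bdd_mul (c := 1) (by fun_prop) (.of_forall fun x => ?_)
    rw [show -(Complex.I * (l : ℂ) * (x : ℂ)) = ((-(l * x) : ℝ) : ℂ) * Complex.I by push_cast; ring]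
    rw [Complex.norm_exp_ofReal_mul_I]
  have hterm : ∀ n : Fin (2 * K), Integrable fun x : ℝ => s (2 * x - ((n : ℕ) : ℝ)) := fun n =>
    (hint.comp_sub_right ((n : ℕ) : ℝ)).comp_mul_left' (R := 2) (by norm_num)
  have hval : ∀ n : Fin (2 * K), ∫ x : ℝ, Complex.exp (-(Complex.I * (l : ℂ) * (x : ℂ))) *
      (s (2 * x - ((n : ℕ) : ℝ)) : ℂ) =
      2⁻¹ * (Complex.exp (-(Complex.I * ((l / 2 : ℝ) : ℂ) * ((n : ℕ) : ℂ))) *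
        scalingHat s (l / 2)) := by
    intro n
    set G : ℝ → ℂ := fun y => Complex.exp (-(Complex.I * ((l / 2 : ℝ) : ℂ) * ((n : ℕ) : ℂ))) *
      (Complex.exp (-(Complex.I * ((l / 2 : ℝ) : ℂ) * (y : ℂ))) * (s y : ℂ)) with hG
    have e1 : ∀ x : ℝ, Complex.exp (-(Complex.I * (l : ℂ) * (x : ℂ))) *
        (s (2 * x - ((n : ℕ) : ℝ)) : ℂ) = G (2 * x - ((n : ℕ) : ℝ)) := by
      intro x
      rw [hG]
      simp only
      rw [← mul_assoc, ← Complex.exp_add]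
      congr 2
      push_cast
      ring
    simp only [e1]
    rw [Measure.integral_comp_mul_left (fun y => G (y - ((n : ℕ) : ℝ))) 2,
      integral_sub_right_eq_self G, hG, integral_const_mul, scalingHat]
    norm_num
  have e : ∀ x : ℝ, Complex.exp (-(Complex.I * (l : ℂ) * (x : ℂ))) * (s x : ℂ) =
      ∑ n : Fin (2 * K), ((h n * √2 : ℝ) : ℂ) * (Complex.exp (-(Complex.I * (l : ℂ) * (x : ℂ))) *
        (s (2 * x - ((n : ℕ) : ℝ)) : ℂ)) := by
    intro x
    conv_lhs => rw [hs.scaling x]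
    push_cast
    rw [Finset.mul_sum]
    exact Finset.sum_congr rfl fun n _ => by ring
  have h3 : ((√2 : ℝ) : ℂ) * 2⁻¹ = ((1 / √2 : ℝ) : ℂ) := by
    rw [← Complex.ofReal_ofNat, ← Complex.ofReal_inv, ← Complex.ofReal_mul]
    congr 1
    field_simp
    norm_num
  rw [scalingHat]
  simp only [e]
  rw [integral_finsetSum _ fun n _ => (hE _ (hterm n)).const_mul _]
  simp only [integral_const_mul, hval]
  rw [lowPass, ← h3, Finset.mul_sum, Finset.sum_mul]
  refine Finset.sum_congr rfl fun n _ => ?_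
  push_cast
  ring

/-- The factor `1 + e^{-il}` has real part `1 + cos l ≥ 1`, and the `j = 0` term alone gives `|q|² ≥
1`. -/
theorem IsDaubechies.lowPass_ne_zero (hs : IsDaubechies K h s) {l : ℝ} (hl : |l| ≤ Real.pi / 2) :
    lowPass h l ≠ 0 := by
  obtain ⟨q, hq⟩ := hs.factorization
  obtain ⟨h1, h2⟩ := hq l
  have hK := hs.two_le
  rw [h1]
  refine mul_ne_zero (pow_ne_zero _ (div_ne_zero ?_ two_ne_zero)) ?_
  · intro h0
    have hre := congrArg Complex.re h0
    rw [show -(Complex.I * (l : ℂ)) = ((-l : ℝ) : ℂ) * Complex.I by push_cast; ring,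
      Complex.add_re, Complex.exp_ofReal_mul_I_re] at hre
    have := Real.cos_nonneg_of_neg_pi_div_two_le_of_le (x := -l)
      (by have := abs_le.1 hl; linarith) (by have := abs_le.1 hl; linarith)
    simp only [Complex.one_re, Complex.zero_re] at hre
    linarith
  · intro h0
    rw [h0, norm_zero] at h2
    have h3 : ((K - 1 + 0).choose 0 : ℝ) * Real.sin (l / 2) ^ (2 * 0) ≤
        ∑ j ∈ Finset.range K, ((K - 1 + j).choose j : ℝ) * Real.sin (l / 2) ^ (2 * j) :=
      Finset.single_le_sum (f := fun j => ((K - 1 + j).choose j : ℝ) * Real.sin (l / 2) ^ (2 * j))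
        (fun j _ => mul_nonneg (Nat.cast_nonneg _) (by rw [pow_mul]; positivity))
        (Finset.mem_range.2 (by omega))
    rw [← h2] at h3
    norm_num at h3

/-- Iterating the two-scale equation only evaluates `m₀` at `l/2, l/4, …`, all in `[-π/2, π/2]`,
where it does not vanish. The remaining factor `ŝ(l/2ⁿ)` tends to `ŝ(0) = 1`. -/
theorem IsDaubechies.scalingHat_ne_zero (hs : IsDaubechies K h s) (hreg : ContDiff ℝ 2 s) {l : ℝ}
    (hl : |l| ≤ Real.pi) : scalingHat s l ≠ 0 := by
  have hiter : ∀ n : ℕ, scalingHat s (l / 2 ^ n) ≠ 0 → scalingHat s l ≠ 0 := by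
    intro n
    induction n with
    | zero => simp
    | succ n ih =>
      intro hn
      refine ih ?_
      rw [hs.scalingHat_two_scale hreg, div_div, ← pow_succ]
      refine mul_ne_zero (hs.lowPass_ne_zero ?_) hn
      rw [abs_div, abs_of_pos (by positivity : (0 : ℝ) < 2 ^ (n + 1)), pow_succ,
        div_le_div_iff₀ (by positivity) (by positivity)]
      have : (1 : ℝ) ≤ 2 ^ n := one_le_pow₀ (by norm_num)
      nlinarith [Real.pi_pos]
  have hlim : Tendsto (fun n : ℕ => scalingHat s (l / 2 ^ n)) atTop (𝓝 1) := by
    have h0 : Tendsto (fun n : ℕ => l / 2 ^ n) atTop (𝓝 0) := by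
      have := (tendsto_pow_atTop_nhds_zero_of_lt_one (r := (1 / 2 : ℝ)) (by norm_num)
        (by norm_num)).const_mul l
      simpa [div_eq_mul_inv] using this
    have := ((continuous_scalingHat (hs.integrable hreg)).tendsto 0).comp h0
    rwa [hs.scalingHat_zero] at this
  obtain ⟨n, hn⟩ := (hlim.eventually_ne one_ne_zero).exists
  exact hiter n hn

theorem IsDaubechies.exists_pos_le_scalingHat (hs : IsDaubechies K h s) (hreg : ContDiff ℝ 2 s) :
    ∃ c : ℝ, 0 < c ∧ ∀ l, |l| ≤ Real.pi → c ≤ ‖scalingHat s l‖ := by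
  obtain ⟨x, hx, hmin⟩ := (isCompact_Icc (a := -Real.pi) (b := Real.pi)).exists_isMinOn
    ⟨0, by constructor <;> linarith [Real.pi_pos]⟩
    (continuous_scalingHat (hs.integrable hreg)).norm.continuousOn
  exact ⟨_, norm_pos_iff.2 (hs.scalingHat_ne_zero hreg (abs_le.2 hx)),
    fun l hl => hmin (abs_le.1 hl)⟩

theorem IsDaubechies.prod_lowPass_mul (hs : IsDaubechies K h s) (hreg : ContDiff ℝ 2 s)
    (g : Geometry) (M d : ℕ) (x : ℝ) :
    (∏ i ∈ Finset.range d, lowPass h (g.eps (M + i + 1) * x)) * scalingHat s (g.eps (M + d) * x) =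
      scalingHat s (g.eps M * x) := by
  induction d with
  | zero => simp
  | succ d ih =>
    rw [← ih, hs.scalingHat_two_scale hreg (g.eps (M + d) * x), Finset.prod_range_succ,
      show g.eps (M + d) * x / 2 = g.eps (M + d + 1) * x by rw [g.eps_succ]; ring, ← add_assoc M d 1]
    ring

/-- The finite product of filters is `ŝ(ε_M k) / ŝ(ε_N k)` in multiplied-out form, and the steps'
factors of `2` restore `ε_M` from `ε_N`. Dividing by `ŝ(ε_N k)` yields both the uniform bound and
the limit of the loops. -/
theorem IsDaubechies.eps_mul_loopScale_mul (hs : IsDaubechies K h s) (hreg : ContDiff ℝ 2 s)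
    (g : Geometry) (M d : ℕ) (Y : ℤ → ℂ) (k : ℤ) :
    (g.eps (M + (d + 1)) : ℂ) * loopScale g h M (d + 1) Y k *
      scalingHat s (g.eps (M + (d + 1)) * loopMom g k) = loopLimit g s M Y k := by
  rw [loopScale_succ_eq, loopLimit, ← hs.prod_lowPass_mul hreg g M (d + 1)]
  have : (g.eps M : ℂ) = g.eps (M + (d + 1)) * 2 ^ (d + 1) := by
    rw [Geometry.eps, Geometry.eps, pow_add]
    push_cast
    field_simp
  rw [this]
  ring

theorem IsDaubechies.exists_norm_loopScale_le (hs : IsDaubechies K h s) (hreg : ContDiff ℝ 2 s) :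
    ∃ C : ℝ, 0 < C ∧ ∀ (g : Geometry) (M d : ℕ) (Y : ℤ → ℂ), ∀ k ∈ g.zone (M + (d + 1)),
      ‖(g.eps (M + (d + 1)) : ℂ) * loopScale g h M (d + 1) Y k‖ ≤ C * ‖loopLimit g s M Y k‖ := by
  obtain ⟨c, hc, hle⟩ := hs.exists_pos_le_scalingHat hreg
  refine ⟨c⁻¹, inv_pos.2 hc, fun g M d Y k hk => ?_⟩
  rw [← hs.eps_mul_loopScale_mul hreg, norm_mul _ (scalingHat _ _), ← div_eq_inv_mul,
    le_div_iff₀ hc]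
  gcongr
  -- On the zone `|k| ≤ L_N`, so `|ε_N k| ≤ π`.
  refine hle _ ?_
  have h1 : (0 : ℝ) < g.num (M + (d + 1)) := Nat.cast_pos.2 (g.num_pos _)
  rw [eps_mul_loopMom, abs_div, abs_mul, abs_of_pos Real.pi_pos, abs_of_pos h1, div_le_iff₀ h1]
  gcongr
  rw [Geometry.zone, Finset.mem_Ico] at hk
  have : |k| ≤ (g.num (M + (d + 1)) : ℤ) := abs_le.2 ⟨hk.1, hk.2.le⟩
  exact_mod_cast this

theorem IsDaubechies.tendsto_loopScale (hs : IsDaubechies K h s) (hreg : ContDiff ℝ 2 s)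
    (g : Geometry) (M : ℕ) (Y : ℤ → ℂ) (k : ℤ) :
    Tendsto (fun d => (g.eps (M + d) : ℂ) * loopScale g h M d Y k) atTop
      (𝓝 (loopLimit g s M Y k)) := by
  -- The identity with `loopLimit` requires at least one step.
  rw [← tendsto_add_atTop_iff_nat 1]
  have h0 : Tendsto (fun d : ℕ => g.eps (M + (d + 1)) * loopMom g k) atTop (𝓝 0) := by
    have := (g.tendsto_eps.comp (tendsto_add_atTop_nat (M + 1))).mul_const (loopMom g k)
    rw [zero_mul] at this
    refine this.congr fun d => ?_
    simp only [Function.comp]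
    congr 2
    omega
  have h1 : Tendsto (fun d : ℕ => scalingHat s (g.eps (M + (d + 1)) * loopMom g k)) atTop
      (𝓝 1) := by
    have := ((continuous_scalingHat (hs.integrable hreg)).tendsto 0).comp h0
    rwa [hs.scalingHat_zero] at this
  have h2 := (h1.inv₀ one_ne_zero).const_mul (loopLimit g s M Y k)
  rw [inv_one, mul_one] at h2
  refine h2.congr' ?_
  filter_upwards [h1.eventually_ne one_ne_zero] with d hd
  rw [← hs.eps_mul_loopScale_mul hreg g M d Y k, mul_assoc, mul_inv_cancel₀ hd, mul_one]

/-! ### Decay of the limit loop -/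

/-- The Fourier transform of a continuous compactly supported function is square-summable along
`(π/n) ℤ`. -/
theorem summable_sq_fourier_of_hasCompactSupport {f : ℝ → ℂ} (hf : Continuous f)
    (hc : HasCompactSupport f) {n : ℕ} (hn : 0 < n) :
    Summable fun k : ℤ => ‖𝓕 f (k / (2 * n))‖ ^ 2 := by
  obtain ⟨R, hR⟩ := hc.isCompact.isBounded.subset_closedBall 0
  -- The period is enlarged by a factor `m` so that the support fits into `(-nm, nm]`. The
  -- frequencies `(π/n) ℤ` then form the sublattice of index `m` in those of this interval, and
  -- Parseval applies there.
  obtain ⟨m, hm⟩ := exists_nat_gt (max R 1)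
  have hm1 : 1 ≤ m := by
    have := (le_max_right R 1).trans hm.le
    exact_mod_cast this
  have hmR : R < m := (le_max_left _ _).trans_lt hm
  have hn' : (0 : ℝ) < n := Nat.cast_pos.2 hn
  have hm' : (0 : ℝ) < m := Nat.cast_pos.2 hm1
  have hab : -((n : ℝ) * m) < n * m := by nlinarith
  have hL2 : MemLp f 2 (volume.restrict (Set.Ioc (-((n : ℝ) * m)) (n * m))) :=
    (hf.memLp_of_hasCompactSupport hc).restrict _
  have hsum := (hasSum_sq_fourierCoeffOn hab hL2).summable
  have hinj : Function.Injective fun k : ℤ => (m : ℤ) * k :=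
    mul_right_injective₀ (by omega)
  -- The factor `2nm`, the length of the interval, undoes the averaging in `fourierCoeffOn`.
  refine ((hsum.comp_injective hinj).mul_left ((2 * (n * m) : ℝ) ^ 2)).congr fun k => ?_
  simp only [Function.comp]
  rw [← mul_pow, fourierCoeffOn_eq_integral, norm_smul, ← mul_assoc, Real.norm_of_nonneg (by
    apply div_nonneg zero_le_one; linarith)]
  rw [show 2 * ((n : ℝ) * m) * (1 / (n * m - -(n * m))) = 1 by field_simp; norm_num, one_mul]
  congr 2
  have hsupp : Function.support f ⊆ Set.Ioc (-((n : ℝ) * m)) (n * m) := by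
    intro x hx
    have h1 : |x| ≤ R := by simpa using hR (subset_tsupport f hx)
    have h2 : (1 : ℝ) ≤ n := by exact_mod_cast hn
    have h3 := abs_le.1 h1
    constructor <;> nlinarith
  rw [Real.fourier_eq', intervalIntegral.integral_eq_integral_of_support_subset]
  · refine integral_congr_ae (.of_forall fun x => ?_)
    simp only [fourier_coe_apply]
    congr 2
    have hm0 : (m : ℂ) ≠ 0 := Nat.cast_ne_zero.2 (by omega)
    simp
    field_simp
    ring
  · exact fun x hx => hsupp fun h0 => hx (by simp [h0])

/-- Up to a constant, `k² ŝ(πk/n)` is the Fourier transform of `s''`, which is continuous with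
compact support. -/
theorem summable_pow_four_mul_scalingHat (hreg : ContDiff ℝ 2 s) (hc : HasCompactSupport s)
    {n : ℕ} (hn : 0 < n) :
    Summable fun k : ℤ => ((k : ℝ) ^ 2 * ‖scalingHat s (Real.pi * k / n)‖) ^ 2 := by
  have hreg' : ContDiff ℝ 2 (fun x => (s x : ℂ)) := Complex.ofRealCLM.contDiff.comp hreg
  have hc' : HasCompactSupport (fun x => (s x : ℂ)) := hc.comp_left Complex.ofReal_zero
  have hcs : ∀ i : ℕ, i ≤ 2 → HasCompactSupport (iteratedDeriv i (fun x => (s x : ℂ))) := by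
    intro i _
    induction i with
    | zero => simpa using hc'
    | succ i ih =>
      rw [iteratedDeriv_succ]
      exact (ih (by omega)).deriv
  have hcont : ∀ i : ℕ, i ≤ 2 → Continuous (iteratedDeriv i (fun x => (s x : ℂ))) := fun i hi =>
    hreg'.continuous_iteratedDeriv i (by exact_mod_cast hi)
  have hF := Real.fourier_iteratedDeriv (N := 2) (n := 2) (f := fun x => (s x : ℂ))
    (by exact_mod_cast hreg') (fun i hi => (hcont i (by exact_mod_cast hi)).integrable_of_hasCompactSupport
      (hcs i (by exact_mod_cast hi))) le_rfl
  have h1 := summable_sq_fourier_of_hasCompactSupport (hcont 2 le_rfl) (hcs 2 le_rfl) hn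
  have hn' : (0 : ℝ) < n := Nat.cast_pos.2 hn
  refine (h1.mul_left (((n / Real.pi) ^ 2) ^ 2)).congr fun k => ?_
  rw [← mul_pow, hF, scalingHat_eq_fourier]
  simp only [norm_smul, norm_pow]
  rw [show Real.pi * k / n / (2 * Real.pi) = (k : ℝ) / (2 * n) by
    have := Real.pi_pos
    field_simp, ← mul_assoc, ← mul_pow]
  congr 2
  have : ‖(2 * (Real.pi : ℂ) * Complex.I * ((((k : ℝ) / (2 * n) : ℝ)) : ℂ))‖ =
      Real.pi * |(k : ℝ)| / n := by
    rw [norm_mul, norm_mul, norm_mul, Complex.norm_I, Complex.norm_real, Complex.norm_real,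
      Real.norm_eq_abs, Real.norm_eq_abs, abs_div, abs_of_pos Real.pi_pos,
      abs_of_pos (by positivity : (0 : ℝ) < 2 * n)]
    simp
    field_simp
  rw [this, show (n / Real.pi * (Real.pi * |(k : ℝ)| / n)) = |(k : ℝ)| by
    have := Real.pi_pos
    field_simp, sq_abs]

theorem IsDaubechies.summable_loopLimit (hs : IsDaubechies K h s) (hreg : ContDiff ℝ 2 s)
    (g : Geometry) (M : ℕ) (Y : ℤ → ℂ) :
    Summable fun k : ℤ => ((1 + (k : ℝ) ^ 2) * ‖loopLimit g s M Y k‖) ^ 2 := by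
  obtain ⟨B, hB⟩ := ((g.zone M).image fun j => ‖Y j‖).bddAbove
  have hB' : ∀ j, ‖Y (g.red M j)‖ ≤ B := fun j =>
    hB (Finset.mem_coe.2 (Finset.mem_image_of_mem _ (g.red_mem_zone M j)))
  have h1 := summable_pow_four_mul_scalingHat hreg hs.compactSupport (g.num_pos M)
  have h2 : Summable fun k : ℤ =>
      ((1 + (k : ℝ) ^ 2) * ‖scalingHat s (Real.pi * k / g.num M)‖) ^ 2 := by
    refine (h1.mul_left 4).of_norm_bounded_eventually ?_
    rw [Filter.eventually_cofinite]
    -- Away from `k = 0` one has `1 + k² ≤ 2k²`, whence the factor `4` after squaring.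
    refine (Set.finite_singleton (0 : ℤ)).subset fun k hk => ?_
    by_contra hk0
    refine hk ?_
    have hk1 : (1 : ℝ) ≤ (k : ℝ) ^ 2 := by
      rw [one_le_sq_iff_one_le_abs]
      exact_mod_cast Int.one_le_abs hk0
    rw [Real.norm_of_nonneg (by positivity), show (4 : ℝ) = 2 ^ 2 by norm_num, ← mul_pow,
      ← mul_assoc]
    gcongr
    linarith
  refine (h2.mul_left ((g.eps M * B) ^ 2)).of_nonneg_of_le (fun _ => by positivity) fun k => ?_
  rw [← mul_pow, loopLimit, norm_mul, norm_mul, Complex.norm_real,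
    Real.norm_of_nonneg (g.eps_pos M).le, eps_mul_loopMom]
  have := g.eps_pos M
  refine pow_le_pow_left₀ (by positivity) ?_ 2
  calc _ = g.eps M * ‖Y (g.red M k)‖ *
        ((1 + (k : ℝ) ^ 2) * ‖scalingHat s (Real.pi * k / g.num M)‖) := by ring
    _ ≤ _ := by
      gcongr
      exact hB' k

end Wavelet

/-! ### Coefficients of the generators and of their approximants -/

section Coefficients

/-- The coefficient of `:π(ψ̂†_{l∓k} ψ̂_l):` in `L_{±,k}`. -/
noncomputable def virasoroCoeff (g : Geometry) (b : Sector) (τ : Chirality) (k l : ℤ) : ℝ :=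
  τ.sgn * (1 / (2 * Real.pi)) * (mom g b l - τ.sgn * loopMom g k / 2)

open Classical in
/-- The factor by which an edge convention weights the mode of index `p`. -/
noncomputable def edgeWeight (g : Geometry) (E : EdgeConvention) (N : ℕ) (p : ℤ) : ℝ :=
  match E with
  | .keep => 1
  | .cut => if p ∈ g.zone N then 1 else 0

/-- The coefficient of `:π(ψ̂†_{l∓k} ψ̂_l):` in the renormalized approximant of `L_{±,k}`. -/
noncomputable def ksCoeff (g : Geometry) (b : Sector) (τ : Chirality) (E : EdgeConvention) (N : ℕ)
    (k l : ℤ) : ℝ :=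
  virasoroCoeff g b τ k l * (Real.cos (g.eps N * loopMom g k / 4) ^ 2 *
    Real.sinc (g.eps N * (mom g b l - τ.sgn * loopMom g k / 2)) *
    (edgeWeight g E N (l - τ.sgn * k) * edgeWeight g E N l))

theorem Chirality.abs_sgn (τ : Chirality) : |(τ.sgn : ℝ)| = 1 := by
  cases τ <;> simp [Chirality.sgn]

theorem Chirality.abs_sgn_mul (τ : Chirality) (x : ℝ) : |(τ.sgn : ℝ) * x| = |x| := by
  rw [abs_mul, τ.abs_sgn, one_mul]

theorem edgeWeight_of_mem (g : Geometry) (E : EdgeConvention) {N : ℕ} {p : ℤ} (hp : p ∈ g.zone N) :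
    edgeWeight g E N p = 1 := by
  cases E <;> simp [edgeWeight, hp]

theorem abs_edgeWeight_le (g : Geometry) (E : EdgeConvention) (N : ℕ) (p : ℤ) :
    |edgeWeight g E N p| ≤ 1 := by
  cases E
  · simp [edgeWeight]
  · simp only [edgeWeight]
    split_ifs <;> simp

theorem renormalizedWave_eq (g : Geometry) (E : EdgeConvention) (N : ℕ) (p : ℤ) :
    renormalizedWave g E N p = ((edgeWeight g E N p * (1 / √(g.eps N)) : ℝ) : ℂ) • wave g p := by
  cases E
  · simp [renormalizedWave, edgeWeight]
  · by_cases hp : p ∈ g.zone N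
    · simp [renormalizedWave, edgeWeight, hp, cutoff_latticeWave g N p hp]
    · rw [renormalizedWave, cutoff, latticeWave, Finsupp.filter_single_of_neg _ hp]
      simp [edgeWeight, hp]

theorem wave_eq (g : Geometry) (p : ℤ) :
    wave g p = ((√(2 * g.L) : ℝ) : ℂ) • Finsupp.single p (1 : ℂ) := by
  rw [wave, Finsupp.smul_single_one]

theorem Geometry.eventually_mem_zone (g : Geometry) (j : ℤ) : ∀ᶠ N in atTop, j ∈ g.zone N := by
  filter_upwards [eventually_ge_atTop j.natAbs] with N hN
  have h1 : N < 2 ^ N := Nat.lt_two_pow_self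
  have h2 : 2 ^ N ≤ g.num N := Nat.le_mul_of_pos_right _ g.L0_pos
  rw [Geometry.zone, Finset.mem_Ico]
  omega

theorem abs_ksCoeff_le (g : Geometry) (b : Sector) (τ : Chirality) (E : EdgeConvention) (N : ℕ)
    (k l : ℤ) : |ksCoeff g b τ E N k l| ≤ |virasoroCoeff g b τ k l| := by
  rw [ksCoeff, abs_mul]
  refine mul_le_of_le_one_right (abs_nonneg _) ?_
  rw [abs_mul, abs_mul, abs_mul, abs_of_nonneg (sq_nonneg (Real.cos _))]
  exact mul_le_one₀ (mul_le_one₀ (Real.cos_sq_le_one _) (abs_nonneg _) (Real.abs_sinc_le_one _))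
    (by positivity) (mul_le_one₀ (abs_edgeWeight_le _ _ _ _) (abs_nonneg _)
      (abs_edgeWeight_le _ _ _ _))

theorem tendsto_ksCoeff (g : Geometry) (b : Sector) (τ : Chirality) (E : EdgeConvention) (k l : ℤ) :
    Tendsto (fun N => ksCoeff g b τ E N k l) atTop (𝓝 (virasoroCoeff g b τ k l)) := by
  have h1 : Tendsto (fun N => Real.cos (g.eps N * loopMom g k / 4) ^ 2) atTop (𝓝 1) := by
    have h0 := (g.tendsto_eps.mul_const (loopMom g k)).div_const 4
    have := ((Real.continuous_cos.tendsto _).comp h0).pow 2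
    simpa using this
  have h2 : Tendsto (fun N => Real.sinc (g.eps N * (mom g b l - τ.sgn * loopMom g k / 2))) atTop
      (𝓝 1) := by
    have h0 := g.tendsto_eps.mul_const (mom g b l - τ.sgn * loopMom g k / 2)
    have := (Real.continuous_sinc.tendsto _).comp h0
    simpa [Function.comp_def] using this
  have h3 : ∀ p, Tendsto (fun N => edgeWeight g E N p) atTop (𝓝 1) := fun p =>
    tendsto_const_nhds.congr' ((g.eventually_mem_zone p).mono fun N hN =>
      (edgeWeight_of_mem g E hN).symm)
  have := ((h1.mul h2).mul ((h3 (l - τ.sgn * k)).mul (h3 l))).const_mul (virasoroCoeff g b τ k l)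
  simpa [ksCoeff] using this

variable {I : Type} [LinearOrder I]

/-- Writing `sin(ε_N x) = ε_N x sinc(ε_N x)` isolates the continuum coefficient. The powers of `ε_N`
cancel: `1/ε_N` comes from the symbol, `1/ε_N` from the two waves, `ε_N` from the sine and `L/L_N =
ε_N` from the prefactor. -/
theorem ksMode_apply (g : Geometry) (b : Sector) (τ : Chirality) (E : EdgeConvention)
    (ρ : QuasiFreeRep I) (N : ℕ) (k : ℤ) (Φ : FockAlg I) :
    ksMode g b τ E ρ N k Φ = ∑ l ∈ g.zone N, (ksCoeff g b τ E N k l : ℂ) •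
      normalOrdered ρ (wave g (l - τ.sgn * k)) (wave g l) Φ := by
  simp only [ksMode, LinearMap.sum_apply, LinearMap.smul_apply, renormalizedWave_eq,
    normalOrdered_smul, smul_smul, ← Complex.ofReal_mul]
  refine Finset.sum_congr rfl fun l _ => ?_
  congr 2
  have he := g.eps_pos N
  have hn : (0 : ℝ) < g.num N := Nat.cast_pos.2 (g.num_pos N)
  have hsq : √(g.eps N) * √(g.eps N) = g.eps N := Real.mul_self_sqrt he.le
  have hpi := Real.pi_pos
  set x := mom g b l - τ.sgn * loopMom g k / 2 with hx
  have hsin : Real.sin (g.eps N * x) = g.eps N * x * Real.sinc (g.eps N * x) := by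
    rcases eq_or_ne (g.eps N * x) 0 with h0 | h0
    · simp [h0]
    · rw [Real.sinc_of_ne_zero h0, mul_div_cancel₀ _ h0]
  have hsr : √(g.eps N) ≠ 0 := by positivity
  rw [ksCoeff, virasoroCoeff, chiralSymbol, ← hx, hsin, ← g.eps_mul_num N]
  rw [show edgeWeight g E N (l - τ.sgn * k) * (1 / √(g.eps N)) *
      (edgeWeight g E N l * (1 / √(g.eps N))) =
      edgeWeight g E N (l - τ.sgn * k) * edgeWeight g E N l * (1 / g.eps N) by
    rw [← hsq]; field_simp; rw [Real.sqrt_sq (by positivity)]]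
  field_simp

theorem toFock_ksSmeared (g : Geometry) (b : Sector) (τ : Chirality) (E : EdgeConvention)
    (ρ : QuasiFreeRep I) (N : ℕ) (Y : ℤ → ℂ) (Φ : FockAlg I) :
    toFock (ksSmeared g b τ E ρ N Y Φ) = ((1 / (2 * g.L) : ℝ) : ℂ) •
      ∑ kl ∈ g.zone N ×ˢ g.zone N, ((g.eps N : ℂ) * Y kl.1 * (ksCoeff g b τ E N kl.1 kl.2 : ℂ)) •
        toFock (normalOrdered ρ (wave g (kl.2 - τ.sgn * kl.1)) (wave g kl.2) Φ) := by
  rw [Finset.sum_product]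
  simp only [ksSmeared, LinearMap.smul_apply, LinearMap.sum_apply, ksMode_apply, map_smul, map_sum,
    mul_smul, ← Finset.smul_sum]
  rw [smul_smul]
  congr 1
  have he := g.eps_pos N
  rw [← Complex.ofReal_mul, ← g.eps_mul_num N]
  congr 1
  field_simp

theorem exists_abs_virasoroCoeff_le (g : Geometry) (b : Sector) (τ : Chirality) (R : ℕ) :
    ∃ D : ℝ, ∀ k l : ℤ, |l| ≤ R + |k| → |virasoroCoeff g b τ k l| ≤ D * (1 + |(k : ℝ)|) := by
  have hL := g.L_pos
  -- Here `|l + shift - τk/2| ≤ R + |k| + 1 + |k|/2 ≤ (R + 2)(1 + |k|)`, and `(1/2π)(π/L) = 1/(2L)`.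
  refine ⟨(R + 2) * (1 / (2 * g.L)), fun k l hl => ?_⟩
  have hl' : |(l : ℝ)| ≤ R + |(k : ℝ)| := by exact_mod_cast hl
  have hsh : |b.shift| ≤ 1 := by cases b <;> norm_num [Sector.shift]
  have e : virasoroCoeff g b τ k l =
      τ.sgn * ((1 / (2 * g.L)) * (l + b.shift - τ.sgn * (k / 2))) := by
    rw [virasoroCoeff, loopMom, mom, mom, Sector.shift]
    have := Real.pi_pos
    field_simp
    ring
  rw [e, τ.abs_sgn_mul, abs_mul, abs_of_pos (by positivity : 0 < 1 / (2 * g.L)), mul_comm, mul_right_comm]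
  gcongr
  have h1 := abs_sub (l + b.shift) (τ.sgn * ((k : ℝ) / 2))
  have h2 := abs_add_le (l : ℝ) b.shift
  rw [τ.abs_sgn_mul, abs_div, abs_two] at h1
  have h3 := abs_nonneg (k : ℝ)
  have hR : (0 : ℝ) ≤ R := Nat.cast_nonneg _
  nlinarith [mul_nonneg hR h3]

/-- At fixed `k` there are `O(1 + |k|)` indices `l`, each with squared coefficient `O((1 + |k|)²)`;
the total `(1 + |k|)³` is absorbed by `(1 + k²)²`. -/
theorem summable_sq_virasoroCoeff (g : Geometry) (b : Sector) (τ : Chirality) (R : ℕ) {Y : ℤ → ℂ}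
    (hY : Summable fun k : ℤ => ((1 + (k : ℝ) ^ 2) * ‖Y k‖) ^ 2) :
    Summable fun kl : ℤ × ℤ =>
      (if |kl.2| ≤ R + |kl.1| then ‖Y kl.1‖ * |virasoroCoeff g b τ kl.1 kl.2| else 0) ^ 2 := by
  obtain ⟨D, hD⟩ := exists_abs_virasoroCoeff_le g b τ R
  have hzero : ∀ k l : ℤ, l ∉ Finset.Icc (-(R + |k|)) (R + |k|) →
      (if |l| ≤ R + |k| then ‖Y k‖ * |virasoroCoeff g b τ k l| else 0) ^ 2 = 0 := by
    intro k l hl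
    rw [if_neg, zero_pow two_ne_zero]
    rwa [Finset.mem_Icc, ← abs_le] at hl
  rw [summable_prod_of_nonneg fun _ => sq_nonneg _]
  refine ⟨fun k => summable_of_ne_finset_zero (hzero k), ?_⟩
  refine (hY.mul_left ((2 * R + 2) * D ^ 2 * 4)).of_nonneg_of_le
    (fun k => tsum_nonneg fun _ => sq_nonneg _) fun k => ?_
  simp only
  rw [tsum_eq_sum (hzero k)]
  have h3 := abs_nonneg (k : ℝ)
  have hcard : ((Finset.Icc (-(R + |k|)) (R + |k|)).card : ℝ) ≤ (2 * R + 2) * (1 + |(k : ℝ)|) := by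
    have : ((Finset.Icc (-((R : ℤ) + |k|)) (R + |k|)).card : ℤ) = 2 * (R + |k|) + 1 := by
      rw [Int.card_Icc]
      have := abs_nonneg k
      omega
    have h2 : ((Finset.Icc (-((R : ℤ) + |k|)) (R + |k|)).card : ℝ) = 2 * (R + |(k : ℝ)|) + 1 := by
      exact_mod_cast this
    rw [h2]
    have hR : (0 : ℝ) ≤ R := Nat.cast_nonneg _
    nlinarith [mul_nonneg hR h3]
  calc ∑ l ∈ Finset.Icc (-(R + |k|)) (R + |k|),
        (if |l| ≤ R + |k| then ‖Y k‖ * |virasoroCoeff g b τ k l| else 0) ^ 2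
      ≤ ∑ l ∈ Finset.Icc (-(R + |k|)) (R + |k|), (‖Y k‖ * (D * (1 + |(k : ℝ)|))) ^ 2 := by
        refine Finset.sum_le_sum fun l hl => ?_
        rw [Finset.mem_Icc, ← abs_le] at hl
        rw [if_pos hl]
        gcongr
        exact hD k l hl
    _ ≤ (2 * R + 2) * (1 + |(k : ℝ)|) * (‖Y k‖ * (D * (1 + |(k : ℝ)|))) ^ 2 := by
        rw [Finset.sum_const, nsmul_eq_mul]
        gcongr
    _ = (2 * R + 2) * D ^ 2 * ‖Y k‖ ^ 2 * (1 + |(k : ℝ)|) ^ 3 := by ring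
    _ ≤ (2 * R + 2) * D ^ 2 * ‖Y k‖ ^ 2 * (4 * (1 + (k : ℝ) ^ 2) ^ 2) := by
        gcongr
        calc (1 + |(k : ℝ)|) ^ 3 ≤ (1 + |(k : ℝ)|) ^ 4 :=
              pow_le_pow_right₀ (by linarith) (by norm_num)
          _ = ((1 + |(k : ℝ)|) ^ 2) ^ 2 := by ring
          _ ≤ (2 * (1 + (k : ℝ) ^ 2)) ^ 2 := by
              gcongr
              rw [← sq_abs (k : ℝ)]
              nlinarith [sq_nonneg (1 - |(k : ℝ)|)]
          _ = 4 * (1 + (k : ℝ) ^ 2) ^ 2 := by ring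
    _ = (2 * R + 2) * D ^ 2 * 4 * ((1 + (k : ℝ) ^ 2) * ‖Y k‖) ^ 2 := by ring

end Coefficients

/-! ### Convergence of the approximants -/

section Convergence

variable {I : Type} [LinearOrder I] {ρ : QuasiFreeRep I} {τ : Chirality} {label : I → ℤ}

theorem normalOrdered_wave (g : Geometry) (ρ : QuasiFreeRep I) (p q : ℤ) :
    normalOrdered ρ (wave g p) (wave g q) = ((√(2 * g.L) * √(2 * g.L) : ℝ) : ℂ) •
      normalOrdered ρ (Finsupp.single p 1) (Finsupp.single q 1) := by
  rw [wave_eq, wave_eq, normalOrdered_smul]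

theorem QuasiFreeRep.IsLocal.isBessel_wave (hρ : ρ.IsLocal τ label) (g : Geometry)
    (Φ : FockAlg I) : IsBessel fun kl : ℤ × ℤ =>
      toFock (normalOrdered ρ (wave g (kl.2 - τ.sgn * kl.1)) (wave g kl.2) Φ) := by
  simp only [normalOrdered_wave, LinearMap.smul_apply, map_smul]
  exact (hρ.isBessel Φ).const_smul _

theorem QuasiFreeRep.IsLocal.exists_wave_eq_zero (hρ : ρ.IsLocal τ label) (g : Geometry)
    (Φ : FockAlg I) : ∃ R : ℕ, ∀ k l : ℤ, ¬ |l| ≤ R + |k| →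
      toFock (normalOrdered ρ (wave g (l - τ.sgn * k)) (wave g l) Φ) = 0 := by
  obtain ⟨R, hR⟩ := hρ.exists_eq_zero Φ
  refine ⟨R.toNat, fun k l h => ?_⟩
  rw [normalOrdered_wave, LinearMap.smul_apply, hR k l (by omega), smul_zero, map_zero]

theorem toFock_virasoroTerm (g : Geometry) (b : Sector) (τ : Chirality) (ρ : QuasiFreeRep I)
    (k : ℤ) (Φ : FockAlg I) (l : ℤ) :
    toFock (virasoroTerm g b τ ρ k Φ l) = (virasoroCoeff g b τ k l : ℂ) •
      toFock (normalOrdered ρ (wave g (l - τ.sgn * k)) (wave g l) Φ) := by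
  rw [virasoroTerm, map_smul, virasoroCoeff]

theorem QuasiFreeRep.IsLocal.summable_virasoroTerm (hρ : ρ.IsLocal τ label) (g : Geometry)
    (b : Sector) (Φ : FockAlg I) (k : ℤ) :
    Summable fun l : ℤ => toFock (virasoroTerm g b τ ρ k Φ l) := by
  obtain ⟨R, hR⟩ := hρ.exists_wave_eq_zero g Φ
  refine summable_of_ne_finset_zero (s := Finset.Icc (-(R + |k|)) (R + |k|)) fun l hl => ?_
  rw [Finset.mem_Icc, ← abs_le] at hl
  rw [toFock_virasoroTerm, hR k l hl, smul_zero]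

/-- Cutting the coefficients off at `|l| ≤ R + |k|` makes them square-summable and changes nothing,
since the bilinears annihilate `Φ` beyond. Unconditional summability over pairs then provides the
iterated sums over `l` and `k`. -/
theorem QuasiFreeRep.IsLocal.summable_prod (hρ : ρ.IsLocal τ label) (g : Geometry)
    (b : Sector) (Φ : FockAlg I) {Y : ℤ → ℂ}
    (hY : Summable fun k : ℤ => ((1 + (k : ℝ) ^ 2) * ‖Y k‖) ^ 2) :
    Summable fun kl : ℤ × ℤ => Y kl.1 • toFock (virasoroTerm g b τ ρ kl.1 Φ kl.2) := by
  obtain ⟨R, hR⟩ := hρ.exists_wave_eq_zero g Φ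
  have hs := (hρ.isBessel_wave g Φ).summable (c := fun kl : ℤ × ℤ =>
    if |kl.2| ≤ R + |kl.1| then Y kl.1 * (virasoroCoeff g b τ kl.1 kl.2 : ℂ) else 0) (by
      refine (summable_sq_virasoroCoeff g b τ R hY).congr fun kl => ?_
      split_ifs <;> simp)
  refine hs.congr fun kl => ?_
  rw [toFock_virasoroTerm, smul_smul]
  split_ifs with h
  · rfl
  · rw [hR _ _ h, smul_zero, smul_zero]

theorem smul_virasoroMode_zero (g : Geometry) (b : Sector) (τ : Chirality) (ρ : QuasiFreeRep I)
    (Φ : FockAlg I) (Y : ℤ → ℂ) (k : ℤ) :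
    Y k • virasoroMode g b τ ρ 0 k Φ = ∑' l : ℤ, Y k • toFock (virasoroTerm g b τ ρ k Φ l) := by
  rw [tsum_const_smul'', virasoroMode]
  simp

theorem QuasiFreeRep.IsLocal.summable_virasoroMode_zero (hρ : ρ.IsLocal τ label) (g : Geometry)
    (b : Sector) (Φ : FockAlg I) {Y : ℤ → ℂ}
    (hY : Summable fun k : ℤ => ((1 + (k : ℝ) ^ 2) * ‖Y k‖) ^ 2) :
    Summable fun k : ℤ => Y k • virasoroMode g b τ ρ 0 k Φ := by
  simp only [smul_virasoroMode_zero]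
  exact (hρ.summable_prod g b Φ hY).prod

theorem QuasiFreeRep.IsLocal.virasoroSmeared_zero (hρ : ρ.IsLocal τ label) (g : Geometry)
    (b : Sector) (Φ : FockAlg I) {Y : ℤ → ℂ}
    (hY : Summable fun k : ℤ => ((1 + (k : ℝ) ^ 2) * ‖Y k‖) ^ 2) :
    virasoroSmeared g b τ ρ 0 Y Φ = ((1 / (2 * g.L) : ℝ) : ℂ) •
      ∑' kl : ℤ × ℤ, Y kl.1 • toFock (virasoroTerm g b τ ρ kl.1 Φ kl.2) := by
  rw [virasoroSmeared, (hρ.summable_prod g b Φ hY).tsum_prod]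
  simp only [smul_virasoroMode_zero]

theorem smul_virasoroMode (g : Geometry) (b : Sector) (τ : Chirality) (ρ : QuasiFreeRep I)
    (z : ℝ) (Φ : FockAlg I) (Y : ℤ → ℂ) (k : ℤ) :
    Y k • virasoroMode g b τ ρ z k Φ = Y k • virasoroMode g b τ ρ 0 k Φ +
      if k = 0 then (Y 0 * z) • toFock Φ else 0 := by
  simp only [virasoroMode, Complex.ofReal_zero, zero_smul, ite_self, add_zero, smul_add]
  split_ifs with h
  · rw [h, smul_smul]
  · rw [smul_zero]

theorem QuasiFreeRep.IsLocal.summable_virasoroMode (hρ : ρ.IsLocal τ label) (g : Geometry)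
    (b : Sector) (z : ℝ) (Φ : FockAlg I) {Y : ℤ → ℂ}
    (hY : Summable fun k : ℤ => ((1 + (k : ℝ) ^ 2) * ‖Y k‖) ^ 2) :
    Summable fun k : ℤ => Y k • virasoroMode g b τ ρ z k Φ := by
  simp only [smul_virasoroMode (z := z)]
  exact (hρ.summable_virasoroMode_zero g b Φ hY).add (hasSum_ite_eq 0 _).summable

theorem QuasiFreeRep.IsLocal.virasoroSmeared_eq (hρ : ρ.IsLocal τ label) (g : Geometry)
    (b : Sector) (z : ℝ) (Φ : FockAlg I) {Y : ℤ → ℂ}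
    (hY : Summable fun k : ℤ => ((1 + (k : ℝ) ^ 2) * ‖Y k‖) ^ 2) :
    virasoroSmeared g b τ ρ z Y Φ = virasoroSmeared g b τ ρ 0 Y Φ +
      (((1 / (2 * g.L) * z : ℝ) : ℂ) * Y 0) • toFock Φ := by
  simp only [virasoroSmeared, smul_virasoroMode (z := z)]
  rw [(hρ.summable_virasoroMode_zero g b Φ hY).tsum_add (hasSum_ite_eq 0 _).summable, tsum_ite_eq,
    smul_add, smul_smul]
  congr 2
  push_cast
  ring

theorem QuasiFreeRep.IsLocal.tendsto_ksSmeared (hρ : ρ.IsLocal τ label) (g : Geometry)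
    (b : Sector) (E : EdgeConvention) {K : ℕ} {h : Fin (2 * K) → ℝ} {s : ℝ → ℝ}
    (hs : IsDaubechies K h s) (hreg : ContDiff ℝ 2 s) (M : ℕ) (Y : ℤ → ℂ) (Φ : FockAlg I) :
    Tendsto (fun d : ℕ => ‖toFock (ksSmeared g b τ E ρ (M + d) (loopScale g h M d Y) Φ)
      - virasoroSmeared g b τ ρ 0 (loopLimit g s M Y) Φ‖) atTop (𝓝 0) := by
  obtain ⟨R, hR⟩ := hρ.exists_wave_eq_zero g Φ
  obtain ⟨C, hC, hle⟩ := hs.exists_norm_loopScale_le hreg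
  have hY := hs.summable_loopLimit hreg g M Y
  set T : ℤ × ℤ → Fock I := fun kl =>
    toFock (normalOrdered ρ (wave g (kl.2 - τ.sgn * kl.1)) (wave g kl.2) Φ) with hT
  set c' : ℤ × ℤ → ℂ := fun kl =>
    if |kl.2| ≤ R + |kl.1| then loopLimit g s M Y kl.1 * (virasoroCoeff g b τ kl.1 kl.2 : ℂ) else 0
    with hc'
  set c : ℕ → ℤ × ℤ → ℂ := fun d kl =>
    if |kl.2| ≤ R + |kl.1| then
      if kl ∈ g.zone (M + d) ×ˢ g.zone (M + d) then
        (g.eps (M + d) : ℂ) * loopScale g h M d Y kl.1 * (ksCoeff g b τ E (M + d) kl.1 kl.2 : ℂ)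
      else 0
    else 0 with hc
  have hleft : ∀ d, toFock (ksSmeared g b τ E ρ (M + d) (loopScale g h M d Y) Φ) =
      ((1 / (2 * g.L) : ℝ) : ℂ) • ∑' kl, c d kl • T kl := fun d => by
    rw [toFock_ksSmeared, tsum_eq_sum (s := g.zone (M + d) ×ˢ g.zone (M + d))]
    · congr 1
      refine Finset.sum_congr rfl fun kl hkl => ?_
      by_cases hkR : |kl.2| ≤ R + |kl.1|
      · simp only [hc, hT, if_pos hkR, if_pos hkl]
      · simp only [hT, hR _ _ hkR, smul_zero]
    · intro kl hkl
      simp only [hc, if_neg hkl, ite_self, zero_smul]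
  have hright : virasoroSmeared g b τ ρ 0 (loopLimit g s M Y) Φ =
      ((1 / (2 * g.L) : ℝ) : ℂ) • ∑' kl, c' kl • T kl := by
    rw [hρ.virasoroSmeared_zero g b Φ hY]
    congr 1
    refine tsum_congr fun kl => ?_
    rw [toFock_virasoroTerm, smul_smul]
    by_cases hkR : |kl.2| ≤ R + |kl.1|
    · simp only [hc', hT, if_pos hkR]
    · simp only [hT, hR _ _ hkR, smul_zero]
  have hmain : Tendsto (fun d => ‖∑' kl, c d kl • T kl - ∑' kl, c' kl • T kl‖) atTop (𝓝 0) := by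
    refine (hρ.isBessel_wave g Φ).tendsto_tsum (W := fun kl => C *
      if |kl.2| ≤ R + |kl.1| then
        ‖loopLimit g s M Y kl.1‖ * |virasoroCoeff g b τ kl.1 kl.2| else 0) ?_ ?_ fun kl => ?_
    · simp only [mul_pow]
      exact (summable_sq_virasoroCoeff g b τ R hY).mul_left _
    -- The loop bound requires at least one renormalization step; on the zone it combines with the
    -- uniform bound on `ksCoeff`.
    · filter_upwards [eventually_ge_atTop 1] with d hd kl
      obtain ⟨d, rfl⟩ := Nat.exists_eq_add_of_le' hd
      simp only [hc]
      split_ifs with h1 h2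
      · rw [norm_mul, Complex.norm_real, Real.norm_eq_abs, ← mul_assoc]
        exact mul_le_mul (hle g M d Y kl.1 (Finset.mem_product.1 h2).1) (abs_ksCoeff_le ..)
          (abs_nonneg _) (by positivity)
      · rw [norm_zero]
        positivity
      · simp
    · simp only [hc, hc']
      split_ifs with h1
      · have hM : Tendsto (fun d => M + d) atTop atTop :=
          tendsto_atTop_mono (fun d => Nat.le_add_left d M) tendsto_id
        have h2 := (hs.tendsto_loopScale hreg g M Y kl.1).mul
          ((Complex.continuous_ofReal.tendsto _).comp
            ((tendsto_ksCoeff g b τ E kl.1 kl.2).comp hM))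
        refine h2.congr' ?_
        filter_upwards [hM.eventually (g.eventually_mem_zone kl.1),
          hM.eventually (g.eventually_mem_zone kl.2)] with d hd1 hd2
        rw [if_pos (Finset.mem_product.2 ⟨hd1, hd2⟩)]
        rfl
      · exact tendsto_const_nhds
  have := hmain.const_mul ‖((1 / (2 * g.L) : ℝ) : ℂ)‖
  rw [mul_zero] at this
  refine this.congr fun d => ?_
  rw [hleft, hright, ← smul_sub, norm_smul]

/-- The zero-point constant adds only a multiple of `Φ` on either side. As `1/(2L_N) = ε_N/(2L)`,
these multiples converge by the loop limit at `k = 0`. -/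
theorem QuasiFreeRep.IsLocal.tendsto_ksSmeared_add (hρ : ρ.IsLocal τ label) (g : Geometry)
    (b : Sector) (E : EdgeConvention) {K : ℕ} {h : Fin (2 * K) → ℝ} {s : ℝ → ℝ}
    (hs : IsDaubechies K h s) (hreg : ContDiff ℝ 2 s) (M : ℕ) (Y : ℤ → ℂ) (z : ℝ)
    (Φ : FockAlg I) :
    Tendsto (fun d : ℕ => ‖toFock (ksSmeared g b τ E ρ (M + d) (loopScale g h M d Y) Φ)
      + (((1 / (2 * (g.num (M + d) : ℝ)) * z : ℝ) : ℂ) * loopScale g h M d Y 0) • toFock Φ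
      - virasoroSmeared g b τ ρ z (loopLimit g s M Y) Φ‖) atTop (𝓝 0) := by
  have h1 := hρ.tendsto_ksSmeared g b E hs hreg M Y Φ
  have h2 : Tendsto (fun d => ((1 / (2 * (g.num (M + d) : ℝ)) * z : ℝ) : ℂ) *
      loopScale g h M d Y 0) atTop
      (𝓝 (((1 / (2 * g.L) * z : ℝ) : ℂ) * loopLimit g s M Y 0)) := by
    refine ((hs.tendsto_loopScale hreg g M Y 0).const_mul _).congr fun d => ?_
    rw [← mul_assoc, ← Complex.ofReal_mul]
    congr 2
    have := g.eps_pos (M + d)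
    have hn : (0 : ℝ) < g.num (M + d) := Nat.cast_pos.2 (g.num_pos _)
    rw [← g.eps_mul_num (M + d)]
    field_simp
  have h3 := (((h2.sub_const (((1 / (2 * g.L) * z : ℝ) : ℂ) * loopLimit g s M Y 0)).norm).mul_const
    ‖toFock Φ‖)
  rw [sub_self, norm_zero, zero_mul] at h3
  have h4 := h1.add h3
  rw [add_zero] at h4
  refine squeeze_zero (fun _ => norm_nonneg _) (fun d => ?_) h4
  rw [hρ.virasoroSmeared_eq g b z Φ (hs.summable_loopLimit hreg g M Y), add_sub_add_comm,
    ← sub_smul, ← norm_smul]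
  exact norm_add_le _ _

end Convergence

end KooSaleur

/-! ### The theorem in both sectors. -/

theorem mainTheorem5 (g : Geometry) (τ : Chirality) (E : EdgeConvention) (K : ℕ)
    (h : Fin (2 * K) → ℝ) (s : ℝ → ℝ) (hs : IsDaubechies K h s) (hreg : ContDiff ℝ 2 s)
    (M : ℕ) (X : g.zone M → ℂ) :
    -- the Neveu-Schwarz sector
    (∀ Φ ∈ finiteParticle ℤ,
      (∀ k : ℤ, Summable fun l : ℤ =>
        toFock (virasoroTerm g .neveuSchwarz τ (repNS τ) k Φ l)) ∧
      (Summable fun k : ℤ =>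
        loopLimit g s M (loopHat g M X) k •
          virasoroMode g .neveuSchwarz τ (repNS τ) 0 k Φ) ∧
      Tendsto (fun d : ℕ =>
        ‖toFock (ksSmeared g .neveuSchwarz τ E (repNS τ) (M + d)
              (loopScale g h M d (loopHat g M X)) Φ)
          - virasoroSmeared g .neveuSchwarz τ (repNS τ) 0
              (loopLimit g s M (loopHat g M X)) Φ‖) atTop (𝓝 0)) ∧
    -- the Ramond sector
    (∀ Φ ∈ finiteParticle Doubled,
      (∀ k : ℤ, Summable fun l : ℤ =>
        toFock (virasoroTerm g .ramond τ (repR τ) k Φ l)) ∧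
      (Summable fun k : ℤ =>
        loopLimit g s M (loopHat g M X) k • virasoroMode g .ramond τ (repR τ) 0 k Φ) ∧
      Tendsto (fun d : ℕ =>
        ‖toFock (ksSmeared g .ramond τ E (repR τ) (M + d)
              (loopScale g h M d (loopHat g M X)) Φ)
          - virasoroSmeared g .ramond τ (repR τ) 0
              (loopLimit g s M (loopHat g M X)) Φ‖) atTop (𝓝 0) ∧
      -- the same with the zero-point constant `1/8` of `L_{±,0}` on both sides
      (Summable fun k : ℤ =>
        loopLimit g s M (loopHat g M X) k • virasoroMode g .ramond τ (repR τ) (1 / 8) k Φ) ∧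
      Tendsto (fun d : ℕ =>
        ‖toFock (ksSmeared g .ramond τ E (repR τ) (M + d)
              (loopScale g h M d (loopHat g M X)) Φ)
          + (((1 / (2 * (g.num (M + d) : ℝ)) * (1 / 8) : ℝ) : ℂ) *
              loopScale g h M d (loopHat g M X) 0) • toFock Φ
          - virasoroSmeared g .ramond τ (repR τ) (1 / 8)
              (loopLimit g s M (loopHat g M X)) Φ‖) atTop (𝓝 0)) := by
  have hY := hs.summable_loopLimit hreg g M (loopHat g M X)
  have hNS := isLocal_repNS τ
  have hR := isLocal_repR τ
  exact ⟨fun Φ _ => ⟨hNS.summable_virasoroTerm g _ Φ, hNS.summable_virasoroMode g _ 0 Φ hY,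
      hNS.tendsto_ksSmeared g _ E hs hreg M _ Φ⟩,
    fun Φ _ => ⟨hR.summable_virasoroTerm g _ Φ, hR.summable_virasoroMode g _ 0 Φ hY,
      hR.tendsto_ksSmeared g _ E hs hreg M _ Φ, hR.summable_virasoroMode g _ (1 / 8) Φ hY,
      hR.tendsto_ksSmeared_add g _ E hs hreg M _ (1 / 8) Φ⟩⟩
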